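/- Lemma. Let $G$ be a finite multigraph (loops and parallel edges allowed), $f:V\to\mathbb Z_{\ge 0}$, and $M$ an $f$-matching, i.e. a set of edges with degree $d(v,M)\le f(v)$ at every vertex $v$ (a loop counts twice). The deficiency of $v$ is $f(v)-d(v,M)$, and $v$ is free if this is positive. Give the edges the weights $w(e)=2$ for $e\in M$ and $w(e)=0$ for $e\notin M$. Let a structured matching be given: the matching $M$, a laminar family of blossoms $A$ (defined below), each with a base vertex $\beta(A)$ and a base edge $\eta(A)$, and duals $y:V\to\mathbb R$, $z\ge 0$ ($z$ supported on the blossoms; $A$ is positive if $z(A)>0$) such that, with $$\widehat{yz}(uv)=y(u)+y(v)+\sum\{z(A): uv\in\gamma(A)\cup(\delta(A,M)\oplus\eta(A))\},$$ unmatched edges have $\widehat{yz}(e)\ge w(e)$, matched edges have $\widehat{yz}(e)\le w(e)$, the edges of positive blossoms are tight ($\widehat{yz}(e)=w(e)$), and all free vertices $\phi$ have the same value $y(\phi)$. Blossoms are defined recursively, each having type $M$ or $\overline M$: a blossom $B$ is the preimage of a closed trail $C$, starting and ending at a node $\alpha$, in the graph with the maximal blossoms properly inside $B$ contracted (edges inside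 a contracted blossom disappear; a vertex in no contracted blossom is an atom). If $\alpha$ is an atom, then $\beta(B)=\alpha$ and the first and last edges of $C$ have the type of $B$; otherwise $B$ has the type, base vertex and base edge of $\alpha$. Consecutive edges of $C$ at an atom have opposite types (the first and last edges are not consecutive). A contracted blossom $A$ has degree $2$ in $C$, and if $A\ne\alpha$ then $\eta(A)$ is in $C$. Unless $\beta(B)$ is free, the base edge $\eta(B)$ is an edge from $\beta(B)$ to a vertex outside $B$, of type opposite to $B$. A blossom whose base vertex is free has unmatched type, its base vertex has deficiency $1$, and its base edge is an artificial matched edge from a dummy vertex $\varepsilon$ to it. Suppose that the structured matching is the one with which the search for an augmenting trail ends. That is, it has a search structure: an alternating forest of tight edges in the graph with all blossoms contracted (the parent edge of an atom, counted as matched for a free root, has type opposite to its child edges; at a blossom two edges alternate if one is its base edge), whose roots are exactly the free vertices and the blossoms with a free base vertex (every free vertex being an atom that is a root, or the base vertex of a root blossom), in which the parent edge of a non-root blossom is its base edge and the edges of the blossoms are tight. And a tight edge has been found that completes the forest paths from its two ends to an alternating trail of the contracted graph between two different roots (or from a root of deficiency at least $2$ to itself). Put $L=-y(\phi)$. Let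 $\mathcal T$ be any collection of edge-disjoint augmenting trails, arbitrarily oriented, in which each vertex occurs as an end at most as often as its deficiency (so that all trails can be augmented together). Track each trail $T\in\mathcal T$ from its first vertex by the shortened rule: when $T$ advances on $uv$ (starting with $u=\varepsilon$, which is in no blossom), for each positive blossom $A\ni v$, $$\iota_A(v)=\begin{cases}\iota_A(u)& u\in A,\\ b& u\notin A\text{ and some trail of }\mathcal T\text{ enters }A\text{ on }\eta(A),\\ p& u\notin A\text{ and no trail of }\mathcal T\text{ enters }A\text{ on }\eta(A),\end{cases}$$ where a trail starting at $\phi$ enters the blossoms with free base vertex $\phi$ on their artificial base edge. With $z_c(v,\iota)=\sum\{z(A): v\in A,\ \iota_A=c\}$, the petalevel of $v$ is $$l_o(v,\iota)=y(v)-y(\phi)+z_p(v,\iota),\qquad l_i(v,\iota)=1-\bigl(y(v)+y(\phi)+z_b(v,\iota)\bigr),$$ with type $i$ if $v$ is reached on an unmatched edge and type $o$ if $v$ is reached on a matched edge or is the start of the trail. Then: 1. The last vertex of every trail of $\mathcal T$ has petalevel $1+2L$. 2. The shortest augmenting trail length is $s=1+2L$: there is an augmenting trail of length $1+2L$, and none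 is shorter. 3. If the duals are integers (as they are in the search), every trail of $\mathcal T$ uses an edge in every layer of the level graph $LG^*$: for each integer $0\le k<1+2L$, the trail has an edge $uv$ that goes from petalevel $k$ at $u$ to petalevel $k+1$ at $v$ and is an edge of $LG^*$ there. Here $LG^*$ has the nodes $(v,j)$, $j\in\{i,o\}$, on level $l_j(v,\iota)$, where $\iota_A=b$ if some trail of $\mathcal T$ enters $A$ on $\eta(A)$ and $\iota_A=p$ otherwise; its last level is $1+2L$, and its edges are the edges of $G$ joining nodes on consecutive levels. -/

import Mathlib

open scoped Graph

namespace FMatch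

variable {V E : Type*}

/-- A directed traversal of an edge: from `src` to `tgt` along `edge`. -/
structure Step (V E : Type*) where
  src : V
  edge : E
  tgt : V

/-- `s` traverses an edge of the multigraph `G` (loops and parallel edges are allowed). -/
def IsStep (G : Graph V E) (s : Step V E) : Prop := G.IsLink s.edge s.src s.tgt

/-- The list of steps `p` is a walk of `G` from `u` to `v`. -/
def IsWalk (G : Graph V E) : V → List (Step V E) → V → Prop
  | u, [], v => u = v
  | u, s :: p, v => s.src = u ∧ IsStep G s ∧ IsWalk G s.tgt p v

/-- The degree of `v` in the edge set `S`; a loop counts twice. -/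
noncomputable def degIn (G : Graph V E) (S : Set E) (v : V) : ℕ :=
  {e ∈ S | G.Inc e v}.ncard + {e ∈ S | G.IsLoopAt e v}.ncard

/-- An `f`-matching: a set of edges with at most `f v` edges at each vertex `v`. -/
structure Matching (G : Graph V E) (f : V → ℕ) where
  edges : Set E
  subset : edges ⊆ E(G)
  degree_le : ∀ v ∈ V(G), degIn G edges v ≤ f v

/-- Two edges have opposite M-types. -/
def OppType (M : Set E) (e e' : E) : Prop := e ∈ M ↔ e' ∉ M

open Classical in
/-- The weight `w(e)`: `2` on matched edges and `0` on unmatched ones. -/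
noncomputable def weight (M : Set E) (e : E) : ℝ := if e ∈ M then 2 else 0

/-- An oriented trail, given by its first vertex, its steps and its last vertex. -/
structure OTrail (V E : Type*) where
  start : V
  steps : List (Step V E)
  finish : V

namespace Matching

variable {G : Graph V E} {f : V → ℕ} (N : Matching G f)

/-- The deficiency of a vertex. -/
noncomputable def deficiency (v : V) : ℕ := f v - degIn G N.edges v

/-- A free vertex: one of positive deficiency. -/
def Free (v : V) : Prop := v ∈ V(G) ∧ 0 < N.deficiency v

/-- An augmenting trail: an alternating trail (no repeated edge) which starts and ends with
unmatched edges, joining free vertices; a closed one needs deficiency at least `2` at its end. -/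
structure IsAugmenting (T : OTrail V E) : Prop where
  ne_nil : T.steps ≠ []
  walk : IsWalk G T.start T.steps T.finish
  nodup : (T.steps.map Step.edge).Nodup
  alternating : T.steps.IsChain (fun s t => OppType N.edges s.edge t.edge)
  first_unmatched : ∀ s ∈ T.steps.head?, s.edge ∉ N.edges
  last_unmatched : ∀ s ∈ T.steps.getLast?, s.edge ∉ N.edges
  start_free : N.Free T.start
  finish_free : N.Free T.finish
  closed : T.start = T.finish → 2 ≤ N.deficiency T.start

open Classical in
/-- A collection of pairwise edge-disjoint oriented augmenting trails that can all be augmented: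
no vertex occurs as an end of trails more often than its deficiency allows. -/
structure IsTrailCollection (𝒯 : Finset (OTrail V E)) : Prop where
  augmenting : ∀ T ∈ 𝒯, N.IsAugmenting T
  disjoint : ∀ T ∈ 𝒯, ∀ T' ∈ 𝒯, T ≠ T' →
    List.Disjoint (T.steps.map Step.edge) (T'.steps.map Step.edge)
  ends_le : ∀ v, ∑ T ∈ 𝒯, ((if T.start = v then 1 else 0) + (if T.finish = v then 1 else 0))
    ≤ N.deficiency v

end Matching

/-! ### Blossoms -/

/-- The raw data of a family of blossoms: their vertex sets, base vertices, M-types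
(`heavy` means M-type `M`), base edges, and the closed trails they are made of.
`η B = none` says that the base edge is the artificial matched edge from the dummy vertex `ε`. -/
structure BlossomData (V E : Type*) where
  blossoms : Finset (Finset V)
  base : Finset V → V
  heavy : Finset V → Prop
  η : Finset V → Option E
  cyc : Finset V → List (Step V E)

namespace BlossomData

variable (𝔅 : BlossomData V E)

/-- `A` is a maximal blossom properly inside `B`: one of the blossoms contracted
in the graph in which `cyc B` is a closed trail. -/
def IsChild (A B : Finset V) : Prop :=
  A ∈ 𝔅.blossoms ∧ A ⊂ B ∧ ∀ A' ∈ 𝔅.blossoms, A ⊂ A' → ¬ A' ⊂ B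

/-- `v` is not in any blossom properly inside `B`. -/
def IsAtomIn (B : Finset V) (v : V) : Prop := ∀ A, 𝔅.IsChild A B → v ∉ A

/-- `u` and `v` are identified when the blossoms properly inside `B` are contracted. -/
def SameNodeIn (B : Finset V) (u v : V) : Prop :=
  u = v ∨ ∃ A, 𝔅.IsChild A B ∧ u ∈ A ∧ v ∈ A

open Classical in
/-- `B` is a blossom: the preimage of a closed trail `cyc B`, starting and ending at a node `α`,
in the graph obtained by contracting the maximal blossoms properly inside `B`. -/
structure IsBlossom {G : Graph V E} {f : V → ℕ} (N : Matching G f) (B : Finset V) : Prop where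
  /- `cyc B` is a closed trail in the contracted graph, and its preimage has vertex set `B`. -/
  ne_nil : 𝔅.cyc B ≠ []
  steps : ∀ s ∈ 𝔅.cyc B, IsStep G s ∧ s.src ∈ B ∧ s.tgt ∈ B
  nodup : ((𝔅.cyc B).map Step.edge).Nodup
  not_internal : ∀ s ∈ 𝔅.cyc B, ∀ A, 𝔅.IsChild A B → ¬ (s.src ∈ A ∧ s.tgt ∈ A)
  chain : (𝔅.cyc B).IsChain (fun s t => 𝔅.SameNodeIn B s.tgt t.src)
  closed : ∀ s ∈ (𝔅.cyc B).head?, ∀ t ∈ (𝔅.cyc B).getLast?, 𝔅.SameNodeIn B t.tgt s.src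
  cover : ∀ v ∈ B, ∃ s ∈ 𝔅.cyc B, 𝔅.SameNodeIn B v s.src
  /- If `α` is an atom, it is the base, and the first and last edges have the M-type of `B`. -/
  base_atom : ∀ s ∈ (𝔅.cyc B).head?, ∀ t ∈ (𝔅.cyc B).getLast?, 𝔅.IsAtomIn B s.src →
    𝔅.base B = s.src ∧ (s.edge ∈ N.edges ↔ 𝔅.heavy B) ∧ (t.edge ∈ N.edges ↔ 𝔅.heavy B)
  /- If `α` is a blossom, it gives `B` its base vertex, base edge and M-type. -/
  base_blossom : ∀ s ∈ (𝔅.cyc B).head?, ∀ A, 𝔅.IsChild A B → s.src ∈ A →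
    𝔅.base B = 𝔅.base A ∧ 𝔅.η B = 𝔅.η A ∧ (𝔅.heavy B ↔ 𝔅.heavy A)
  /- Consecutive edges at an atom alternate (the first and last edges are not consecutive). -/
  alternating : (𝔅.cyc B).IsChain
    (fun s t => 𝔅.IsAtomIn B s.tgt → OppType N.edges s.edge t.edge)
  /- A contracted blossom has degree two on `cyc B`. -/
  degree_two : ∀ A, 𝔅.IsChild A B →
    (𝔅.cyc B).countP (fun s => s.src ∈ A) + (𝔅.cyc B).countP (fun s => s.tgt ∈ A) = 2
  /- The base edge of a contracted blossom other than `α` is on `cyc B`. -/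
  child_base_edge : ∀ s ∈ (𝔅.cyc B).head?, ∀ A, 𝔅.IsChild A B → s.src ∉ A →
    ∃ t ∈ 𝔅.cyc B, 𝔅.η A = some t.edge
  /- A base edge in `G` leaves `B` from the base vertex, and has M-type opposite to `B`. -/
  base_edge : ∀ e, 𝔅.η B = some e →
    (∃ x, x ∉ B ∧ G.IsLink e (𝔅.base B) x) ∧ (e ∈ N.edges ↔ ¬ 𝔅.heavy B)
  /- Exactly the blossoms with a free base vertex have the artificial base edge; such a free
  blossom is light and its base vertex has deficiency 1. -/
  artificial_iff : 𝔅.η B = none ↔ N.Free (𝔅.base B)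
  free_light : N.Free (𝔅.base B) → ¬ 𝔅.heavy B ∧ N.deficiency (𝔅.base B) = 1

/-- The edge `e` belongs to the subgraph `E(B)` of the blossom `B`. -/
def InSubgraph (B : Finset V) (e : E) : Prop :=
  ∃ A ∈ 𝔅.blossoms, A ⊆ B ∧ ∃ s ∈ 𝔅.cyc A, s.edge = e

open Classical in
/-- The node containing `v` when all blossoms are contracted: the maximal blossom containing `v`,
or `{v}` if `v` is an atom. (The blossoms are laminar.) -/
noncomputable def node (v : V) : Finset V :=
  insert v ((𝔅.blossoms.filter (fun B => v ∈ B)).sup id)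

/-- `v` is the base vertex of the node `X`, i.e. of a blossom, or of an atom `{v}`. -/
def IsNodeBase (X : Finset V) (v : V) : Prop :=
  (X ∈ 𝔅.blossoms ∧ 𝔅.base X = v) ∨ (X ∉ 𝔅.blossoms ∧ X = {v})

end BlossomData

/-! ### Duals and structured matchings -/

/-- `e` (traversed by `s`) is in `I(B) = δ(V(B), M) ⊕ η(B)`. -/
def InI (M : Set E) (𝔅 : BlossomData V E) (B : Finset V) (s : Step V E) : Prop :=
  Xor (s.edge ∈ M ∧ Xor (s.src ∈ B) (s.tgt ∈ B)) (𝔅.η B = some s.edge)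

open Classical in
/-- `yz(e) = y(e) + z {B | e ∈ γ(B) ∪ I(B)}`, for the edge `e` traversed by `s`. -/
noncomputable def hyz (M : Set E) (𝔅 : BlossomData V E) (y : V → ℝ) (z : Finset V → ℝ)
    (s : Step V E) : ℝ :=
  y s.src + y s.tgt +
    ∑ B ∈ 𝔅.blossoms with (s.src ∈ B ∧ s.tgt ∈ B) ∨ InI M 𝔅 B s, z B

/-- A structured matching: an `f`-matching, a laminar family of (positive and zero) blossoms and
duals `y`, `z` (with `z` supported on the family), where unmatched edges are dominated, matched
edges underrated, the edges of positive blossoms tight, and `y` has one common value `yFree`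
on the free vertices. A positive blossom is a blossom `B` with `0 < z B`. -/
structure StructuredMatching (G : Graph V E) (f : V → ℕ) extends Matching G f where
  𝔅 : BlossomData V E
  y : V → ℝ
  z : Finset V → ℝ
  yFree : ℝ
  laminar : ∀ A ∈ 𝔅.blossoms, ∀ B ∈ 𝔅.blossoms, A ⊆ B ∨ B ⊆ A ∨ Disjoint A B
  isBlossom : ∀ B ∈ 𝔅.blossoms, 𝔅.IsBlossom toMatching B
  z_nonneg : ∀ B, 0 ≤ z B
  z_support : ∀ B, B ∉ 𝔅.blossoms → z B = 0
  dominated : ∀ s, IsStep G s → s.edge ∉ edges → weight edges s.edge ≤ hyz edges 𝔅 y z s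
  underrated : ∀ s, IsStep G s → s.edge ∈ edges → hyz edges 𝔅 y z s ≤ weight edges s.edge
  tight_positive : ∀ B ∈ 𝔅.blossoms, 0 < z B → ∀ s, IsStep G s → 𝔅.InSubgraph B s.edge →
    hyz edges 𝔅 y z s = weight edges s.edge
  y_free : ∀ v, toMatching.Free v → y v = yFree

/-! ### The search structure -/

/-- `p` is the sequence of parent steps from the node `X` up to the root `R`, where `τ X` is the
step from `X` to its parent (`none` for roots). -/
inductive ParentPath (node : V → Finset V) (τ : Finset V → Option (Step V E)) :
    Finset V → List (Step V E) → Finset V → Prop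
  | root (X : Finset V) : τ X = none → ParentPath node τ X [] X
  | cons (X : Finset V) (s : Step V E) (p : List (Step V E)) (R : Finset V) :
      τ X = some s → ParentPath node τ (node s.tgt) p R → ParentPath node τ X (s :: p) R

namespace StructuredMatching

variable {G : Graph V E} {f : V → ℕ} (D : StructuredMatching G f)

/-- The edge traversed by `s` is tight. -/
def Tight (s : Step V E) : Prop := hyz D.edges D.𝔅 D.y D.z s = weight D.edges s.edge

/-- `L = -y(φ)`. -/
def L : ℝ := - D.yFree

end StructuredMatching

/-- A search structure for `D`: a forest in the graph with all blossoms contracted. A root has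
`τ X = none`, and then `τ(X)` stands for the artificial matched edge from `ε`. -/
structure SearchStructure {G : Graph V E} {f : V → ℕ} (D : StructuredMatching G f) where
  nodes : Finset (Finset V)
  τ : Finset V → Option (Step V E)
  nodes_spec : ∀ X ∈ nodes, ∃ v ∈ V(G), X = D.𝔅.node v
  /- parent edges are tight edges joining a node to another node of the structure -/
  parent : ∀ X ∈ nodes, ∀ s, τ X = some s →
    IsStep G s ∧ s.src ∈ X ∧ D.𝔅.node s.tgt ∈ nodes ∧ D.Tight s
  forest : ∀ X ∈ nodes, ∃ p R, ParentPath D.𝔅.node τ X p R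
  /- the roots are the free vertices and free blossoms -/
  root_free : ∀ X ∈ nodes, τ X = none → ∃ v, D.𝔅.IsNodeBase X v ∧ D.Free v
  free_root : ∀ v, D.Free v →
    D.𝔅.node v ∈ nodes ∧ τ (D.𝔅.node v) = none ∧ D.𝔅.IsNodeBase (D.𝔅.node v) v
  /- the parent edge of a blossom is its base edge -/
  parent_blossom : ∀ X ∈ nodes, X ∈ D.𝔅.blossoms → D.𝔅.η X = (τ X).map Step.edge
  /- the edge `τ(X)` of an atom `X` alternates with each child edge of `X` -/
  alternating : ∀ X ∈ nodes, ∀ s, τ X = some s → D.𝔅.node s.tgt ∉ D.𝔅.blossoms →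
    (s.edge ∈ D.edges ↔ ∃ t ∈ τ (D.𝔅.node s.tgt), t.edge ∉ D.edges)
  /- the edges of the blossoms of the structure are tight -/
  tight_blossom : ∀ X ∈ nodes, X ∈ D.𝔅.blossoms → ∀ s, IsStep G s →
    D.𝔅.InSubgraph X s.edge → D.Tight s

namespace SearchStructure

variable {G : Graph V E} {f : V → ℕ} {D : StructuredMatching G f} (S : SearchStructure D)

/-- An edge `e` that is incident to the node `X` alternates with `τ(X)`, if `X` is an atom. -/
def AlternatesAt (X : Finset V) (e : E) : Prop :=
  X ∉ D.𝔅.blossoms → (e ∈ D.edges ↔ ∃ t ∈ S.τ X, t.edge ∉ D.edges)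

/-- The search has found an augmenting trail: some tight edge `s` joins two nodes, alternating at
its ends, and completes their two edge-disjoint paths to the roots to an alternating trail of the
contracted graph between two different roots, or from a root of deficiency at least 2 to itself. -/
def FindsAugmentingTrail : Prop :=
  ∃ (s : Step V E) (p q : List (Step V E)) (R R' : Finset V) (r r' : V),
    IsStep G s ∧ D.Tight s ∧
    D.𝔅.node s.src ∈ S.nodes ∧ D.𝔅.node s.tgt ∈ S.nodes ∧
    S.AlternatesAt (D.𝔅.node s.src) s.edge ∧ S.AlternatesAt (D.𝔅.node s.tgt) s.edge ∧
    ParentPath D.𝔅.node S.τ (D.𝔅.node s.src) p R ∧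
    ParentPath D.𝔅.node S.τ (D.𝔅.node s.tgt) q R' ∧
    ((p ++ s :: q).map Step.edge).Nodup ∧
    D.𝔅.IsNodeBase R r ∧ D.𝔅.IsNodeBase R' r' ∧
    (r = r' → 2 ≤ D.deficiency r)

end SearchStructure

/-! ### Petalevels -/

/-- The io-types. -/
inductive IOType
  | i
  | o

/-- The io-type opposite to `j`. -/
def IOType.opp : IOType → IOType
  | .i => .o
  | .o => .i

open Classical in
/-- `j(μ(e))`: `i` for an unmatched edge and `o` for a matched one. -/
noncomputable def ioType (M : Set E) (e : E) : IOType := if e ∈ M then .o else .i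

/-- The in-values: `b` (base) and `p` (petal). -/
inductive InValue
  | b
  | p

namespace StructuredMatching

variable {G : Graph V E} {f : V → ℕ} (D : StructuredMatching G f)

open Classical in
/-- `z_c(v, ι) = z {A | v ∈ A, ι_A = c}`. -/
noncomputable def zIn (c : InValue) (v : V) (ι : Finset V → InValue) : ℝ :=
  ∑ A ∈ D.𝔅.blossoms with v ∈ A ∧ ι A = c, D.z A

/-- The petalevel `l_j(v, ι)`. -/
noncomputable def petalevel (j : IOType) (v : V) (ι : Finset V → InValue) : ℝ :=
  match j with
  | .o => D.y v - D.yFree + D.zIn .p v ι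
  | .i => 1 - (D.y v + D.yFree + D.zIn .b v ι)

/-- Some trail of `𝒯` enters `A` on its base edge. The artificial base edge of a free blossom is
traversed into the blossom by exactly the trails that start at the base vertex. -/
def EntersOnBase (𝒯 : Finset (OTrail V E)) (A : Finset V) : Prop :=
  match D.𝔅.η A with
  | none => ∃ T ∈ 𝒯, T.start = D.𝔅.base A
  | some e => ∃ T ∈ 𝒯, ∃ s ∈ T.steps, s.edge = e ∧ s.src ∉ A ∧ s.tgt ∈ A

open Classical in
/-- The in-value that the shortened rule gives to a trail entering `A`. -/
noncomputable def entryValue (𝒯 : Finset (OTrail V E)) (A : Finset V) : InValue :=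
  if D.EntersOnBase 𝒯 A then .b else .p

open Classical in
/-- The shortened rule: the entrance sequence after a trail advances by the step `s`. -/
noncomputable def advance (𝒯 : Finset (OTrail V E)) (ι : Finset V → InValue) (s : Step V E) :
    Finset V → InValue :=
  fun A => if s.src ∈ A then ι A else D.entryValue 𝒯 A

/-- The entrance sequence, by the shortened rule, of the vertex that `T` reaches after `n` steps.
The start of `T` is entered from `ε`, which is in no blossom. -/
noncomputable def entrance (𝒯 : Finset (OTrail V E)) (T : OTrail V E) (n : ℕ) :
    Finset V → InValue :=
  (T.steps.take n).foldl (D.advance 𝒯) (D.entryValue 𝒯)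

/-- The level in `LG*` of the node `(v, j)`; its in-values are the entry values of the blossoms. -/
noncomputable def lgLevel (𝒯 : Finset (OTrail V E)) (x : V × IOType) : ℝ :=
  D.petalevel x.2 x.1 (D.entryValue 𝒯)

/-- `e` gives an edge of `LG*` from the node `x` to the node `x'` in layer `k`, i.e. from level `k`
to level `k + 1`. The last level of `LG*` is `1 + 2L`. -/
def IsLGEdge (𝒯 : Finset (OTrail V E)) (k : ℕ) (e : E) (x x' : V × IOType) : Prop :=
  G.IsLink e x.1 x'.1 ∧ D.lgLevel 𝒯 x = k ∧ D.lgLevel 𝒯 x' = k + 1 ∧ (k + 1 : ℝ) ≤ 1 + 2 * D.L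

/-- The duals are integers. -/
def IntegralDuals : Prop :=
  (∀ v ∈ V(G), ∃ n : ℤ, D.y v = n) ∧ ∀ B ∈ D.𝔅.blossoms, ∃ n : ℤ, D.z B = n

end StructuredMatching

end FMatch

/-!
Along an augmenting trail, the petalevel starts at `0`, ends at `1 + 2L`, and grows by at most one
per step; and some augmenting trail has length at most `1 + 2L`.

*Levels.* The shortened rule gives a blossom the same in-value whenever it is entered, so the
petalevel is a function of the vertex and the io-type (`entrance_eq`). For a step along an
unmatched edge, the gain is `1` minus a sum of duals that contains all of those in `yz(e) ≥ 0`; for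
a matched edge it is at most `yz(e) - 1 ≤ 1`. Both hold because a blossom left on its base edge is
not also entered on it (`lgLevel_step_le`). A free vertex is the base vertex of every blossom
containing it, where it has deficiency 1, so it cannot be both the start of one trail and the end of
another; hence the values at the ends (`lgLevel_start`, `lgLevel_finish`). This gives the first and
third claims and the lower bound on the length (`le_length`).

*A trail of length `1 + 2L`.* Instead of trails through blossoms, the proof constructs a set `F` of
tight edges in which every vertex has equally many matched and unmatched edges, apart from one extra
unmatched edge for each of the ends `r` and `r'`, and such that, for every blossom `A`,
`|F ∩ δ(A)| = 2 [η(A) ∈ F] + [r ∈ A] + [r' ∈ A]`. In the signed sum of the tight duals over `F`, the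
condition on `A` makes the contribution of `z(A)` vanish, and what is left is `|F| = 1 + 2L`
(`IsPartialTrail.card_eq`). A balanced edge set contains an alternating trail from `r` to `r'`,
which is found greedily (`exists_alternating_trail`).

The set `F` comes from the edges found by the search, which satisfy the conditions in the graph with
all blossoms contracted (`exists_isPartialTrail`). The contracted blossoms are then expanded from
the outside in. If `F` meets a maximal contracted blossom `A`, it does so with its base edge (a
genuine or the artificial one) and one more edge, ending at a vertex `w` of `A`
(`IsPartialTrail.entry_cases`); one of the two parts into which the node of `w` splits the closed
trail of `A` extends `F` to the graph in which only the children of `A` are contracted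
(`exists_cyc_part`).
-/

namespace FMatch

variable {V E : Type*}

open Classical

variable {G : Graph V E} {M : Set E}

/-! ### Signed and unsigned incidence counts -/

/-- The sign of an edge: `1` if it is unmatched and `-1` if it is matched. -/
noncomputable def sgn (M : Set E) (e : E) : ℤ := if e ∈ M then -1 else 1

/-- The number of ends of the edge `e` at `x`; a loop has two. -/
noncomputable def mult (G : Graph V E) (e : E) (x : V) : ℤ :=
  (if G.Inc e x then 1 else 0) + (if G.IsLoopAt e x then 1 else 0)

/-- The number of unmatched minus the number of matched edges of `F` at `x`; loops count twice. -/
noncomputable def bal (G : Graph V E) (M : Set E) (F : Finset E) (x : V) : ℤ :=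
  ∑ e ∈ F, sgn M e * mult G e x

/-- The edge `e` joins a vertex of `A` to a vertex outside `A`. -/
def Crosses (G : Graph V E) (e : E) (A : Finset V) : Prop :=
  ∃ x y, G.IsLink e x y ∧ x ∈ A ∧ y ∉ A

/-- The number of edges of `F` that leave `A`. -/
noncomputable def cut (G : Graph V E) (F : Finset E) (A : Finset V) : ℤ :=
  ∑ e ∈ F, if Crosses G e A then 1 else 0


lemma sgn_cases (M : Set E) (e : E) : sgn M e = 1 ∨ sgn M e = -1 := by
  unfold sgn; split_ifs <;> simp

lemma OppType.sgn_eq {e e' : E} (h : OppType M e e') : sgn M e' = -sgn M e := by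
  unfold OppType at h
  unfold sgn
  by_cases h1 : e ∈ M <;> by_cases h2 : e' ∈ M <;> simp_all

lemma mult_step {s : Step V E} (hs : IsStep G s) (x : V) :
    mult G s.edge x = (if s.src = x then 1 else 0) + (if s.tgt = x then 1 else 0) := by
  have hs' : G.IsLink s.edge s.src s.tgt := hs
  have h1 : G.Inc s.edge x ↔ s.src = x ∨ s.tgt = x := by
    constructor
    · intro h
      rcases h.eq_or_eq_of_isLink hs' with h | h
      exacts [Or.inl h.symm, Or.inr h.symm]
    · rintro (rfl | rfl)
      exacts [hs'.inc_left, hs'.inc_right]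
  have h2 : G.IsLoopAt s.edge x ↔ s.src = x ∧ s.tgt = x := by
    constructor
    · intro h
      have h3 : G.IsLink s.edge x x := h
      rcases hs'.eq_and_eq_or_eq_and_eq h3 with h | h <;> exact ⟨h.1, h.2⟩
    · rintro ⟨h, h'⟩
      rw [h, h'] at hs'
      exact hs'
  unfold mult
  simp only [h1, h2]
  by_cases h3 : s.src = x <;> by_cases h4 : s.tgt = x <;> simp [h3, h4]

lemma sum_mult_step {s : Step V E} (hs : IsStep G s) (A : Finset V) :
    ∑ x ∈ A, mult G s.edge x = (if s.src ∈ A then 1 else 0) + (if s.tgt ∈ A then 1 else 0) := by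
  simp only [mult_step hs, Finset.sum_add_distrib, Finset.sum_ite_eq]

lemma crosses_step {s : Step V E} (hs : IsStep G s) (A : Finset V) :
    Crosses G s.edge A ↔ Xor (s.src ∈ A) (s.tgt ∈ A) := by
  have hs' : G.IsLink s.edge s.src s.tgt := hs
  constructor
  · rintro ⟨x, y, h, hx, hy⟩
    rcases hs'.eq_and_eq_or_eq_and_eq h with ⟨h1, h2⟩ | ⟨h1, h2⟩
    · rw [h1, h2]; exact Or.inl ⟨hx, hy⟩
    · rw [h1, h2]; exact Or.inr ⟨hx, hy⟩
  · rintro (h | h)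
    · exact ⟨_, _, hs', h.1, h.2⟩
    · exact ⟨_, _, hs'.symm, h.1, h.2⟩

lemma exists_step {e : E} (he : e ∈ E(G)) : ∃ s : Step V E, IsStep G s ∧ s.edge = e := by
  obtain ⟨x, y, h⟩ := Graph.exists_isLink_of_mem_edgeSet he
  exact ⟨⟨x, e, y⟩, h, rfl⟩

lemma IsStep.mem_edgeSet {s : Step V E} (hs : IsStep G s) : s.edge ∈ E(G) :=
  Graph.IsLink.edge_mem hs

/-- The sum of an edge function over the edges of a trail. -/
lemma sum_edges_toFinset {p : List (Step V E)} (hp : (p.map Step.edge).Nodup) (g : E → ℤ) :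
    ∑ e ∈ (p.map Step.edge).toFinset, g e = (p.map fun s => g s.edge).sum := by
  rw [List.sum_toFinset g hp, List.map_map]; rfl

/-! ### Alternating trails in balanced edge sets -/

/-- In an edge set that is balanced except for a surplus of the sign `ς` at `v` and of unmatched
edges at `r'`, there is an alternating trail from `v`, starting with sign `ς`, to `r'`, ending with
an unmatched edge. A trail that gets stuck can only be at `r'`. -/
lemma exists_alternating_trail (r' : V) (n : ℕ) : ∀ (R : Finset E) (v : V) (ς : ℤ),
    R.card = n → (∀ e ∈ R, e ∈ E(G)) → (ς = 1 ∨ ς = -1) →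
    (∀ x, bal G M R x = ς * (if v = x then 1 else 0) + (if r' = x then 1 else 0)) →
    ∃ p : List (Step V E), IsWalk G v p r' ∧ (p.map Step.edge).Nodup ∧
      (∀ s ∈ p, s.edge ∈ R) ∧ p.IsChain (fun s t => OppType M s.edge t.edge) ∧
      (∀ s ∈ p.head?, sgn M s.edge = ς) ∧ (∀ s ∈ p.getLast?, s.edge ∉ M) ∧
      (p = [] → ς = -1) := by
  induction n with
  | zero =>
    intro R v ς hR hE hς hbal
    obtain rfl := Finset.card_eq_zero.mp hR
    have h := hbal v
    simp only [bal, Finset.sum_empty, if_true] at h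
    have h1 : ς = -1 ∧ r' = v := by
      split_ifs at h with h2
      · exact ⟨by omega, h2⟩
      · omega
    exact ⟨[], h1.2.symm, by simp, by simp, by simp, by simp, by simp, fun _ => h1.1⟩
  | succ n ih =>
    intro R v ς hR hE hς hbal
    by_cases h0 : ς = -1 ∧ r' = v
    · exact ⟨[], h0.2.symm, by simp, by simp, by simp, by simp, by simp, fun _ => h0.1⟩
    have hv := hbal v
    -- The surplus at `v` provides an edge of sign `ς`.
    have hex : ∃ e ∈ R, sgn M e = ς ∧ mult G e v ≠ 0 := by
      by_contra hno
      push Not at hno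
      have hle : ς * bal G M R v ≤ 0 := by
        rw [bal, Finset.mul_sum]
        refine Finset.sum_nonpos fun e he => ?_
        have hm : 0 ≤ mult G e v := by unfold mult; split_ifs <;> simp
        by_cases h1 : sgn M e = ς
        · simp [hno e he h1]
        · have h2 : sgn M e = -ς := by
            rcases sgn_cases M e with h | h <;> rcases hς with h' | h' <;> omega
          rw [h2]
          rcases hς with h' | h' <;> rw [h'] <;> nlinarith
      rw [hv] at hle
      rcases hς with h' | h' <;> simp only [h', if_true] at hle h0 <;> split_ifs at hle <;> simp_all
    obtain ⟨e, heR, hes, hem⟩ := hex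
    have hinc : G.Inc e v := by
      by_contra h
      apply hem
      have : ¬ G.IsLoopAt e v := fun h' => h h'.inc
      simp [mult, h, this]
    obtain ⟨u, hu⟩ := hinc
    have hstep : IsStep G (⟨v, e, u⟩ : Step V E) := hu
    obtain ⟨p, hp1, hp2, hp3, hp4, hp5, hp6, hp7⟩ := ih (R.erase e) u (-ς)
      (by rw [Finset.card_erase_of_mem heR, hR]; rfl)
      (fun e' he' => hE e' (Finset.mem_of_mem_erase he')) (by omega) (by
        intro x
        have h1 := hbal x
        have h2 : bal G M (R.erase e) x + sgn M e * mult G e x = bal G M R x :=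
          Finset.sum_erase_add _ _ heR
        have h3 := mult_step hstep x
        simp only at h3
        rw [h3, hes, h1] at h2
        linarith)
    refine ⟨⟨v, e, u⟩ :: p, ⟨rfl, hstep, hp1⟩, ?_, ?_, ?_, ?_, ?_, by simp⟩
    · rw [List.map_cons, List.nodup_cons]
      refine ⟨fun h => ?_, hp2⟩
      obtain ⟨s, hs, hse⟩ := List.mem_map.mp h
      have := hp3 s hs
      rw [hse] at this
      simp at this
    · intro s hs
      rcases List.mem_cons.mp hs with rfl | hs
      · exact heR
      · exact Finset.mem_of_mem_erase (hp3 s hs)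
    · cases p with
      | nil => simp
      | cons t p =>
        rw [List.isChain_cons_cons]
        refine ⟨?_, hp4⟩
        have h1 := hp5 t (by simp)
        rw [← hes] at h1
        simp only [OppType]
        unfold sgn at h1
        by_cases h3 : e ∈ M <;> by_cases h4 : t.edge ∈ M <;> simp_all
    · intro s hs
      simp only [List.head?_cons, Option.mem_def, Option.some.injEq] at hs
      rw [← hs]; exact hes
    · cases p with
      | nil =>
        have h1 := hp7 rfl
        intro s hs
        simp only [List.getLast?_singleton, Option.mem_def, Option.some.injEq] at hs
        rw [← hs]
        intro h2
        simp only [sgn, h2, if_true] at hes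
        omega
      | cons t p =>
        intro s hs
        rw [List.getLast?_cons_cons] at hs
        exact hp6 s hs

/-! ### Telescoping sums along closed trails of contracted graphs -/

/-- The sum over the edges of a list of steps of the signed incidences with `x`. -/
noncomputable def listBal (M : Set E) (p : List (Step V E)) (x : V) : ℤ :=
  (p.map fun s => sgn M s.edge *
    ((if s.src = x then 1 else 0) + (if s.tgt = x then 1 else 0))).sum

/-- The number of steps of `p` which start in `A`. -/
noncomputable def srcCount (A : Finset V) (p : List (Step V E)) : ℤ :=
  (p.map fun s => if s.src ∈ A then (1 : ℤ) else 0).sum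

/-- The number of steps of `p` which end in `A`. -/
noncomputable def tgtCount (A : Finset V) (p : List (Step V E)) : ℤ :=
  (p.map fun s => if s.tgt ∈ A then (1 : ℤ) else 0).sum

lemma srcCount_eq_countP (A : Finset V) (p : List (Step V E)) :
    srcCount A p = (p.countP fun s => s.src ∈ A) := by
  induction p with
  | nil => simp [srcCount]
  | cons s p ih =>
    have : srcCount A (s :: p) = (if s.src ∈ A then 1 else 0) + srcCount A p := by simp [srcCount]
    rw [this, ih, List.countP_cons]
    split_ifs <;> simp_all [add_comm]

lemma tgtCount_eq_countP (A : Finset V) (p : List (Step V E)) :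
    tgtCount A p = (p.countP fun s => s.tgt ∈ A) := by
  induction p with
  | nil => simp [tgtCount]
  | cons s p ih =>
    have : tgtCount A (s :: p) = (if s.tgt ∈ A then 1 else 0) + tgtCount A p := by simp [tgtCount]
    rw [this, ih, List.countP_cons]
    split_ifs <;> simp_all [add_comm]

@[simp] lemma listBal_nil (x : V) : listBal M ([] : List (Step V E)) x = 0 := by simp [listBal]

@[simp] lemma listBal_cons (s : Step V E) (p : List (Step V E)) (x : V) :
    listBal M (s :: p) x = sgn M s.edge *
      ((if s.src = x then 1 else 0) + (if s.tgt = x then 1 else 0)) + listBal M p x := by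
  simp [listBal]

@[simp] lemma listBal_append (p q : List (Step V E)) (x : V) :
    listBal M (p ++ q) x = listBal M p x + listBal M q x := by
  simp [listBal]

@[simp] lemma srcCount_nil (A : Finset V) : srcCount A ([] : List (Step V E)) = 0 := by
  simp [srcCount]

@[simp] lemma srcCount_cons (A : Finset V) (s : Step V E) (p : List (Step V E)) :
    srcCount A (s :: p) = (if s.src ∈ A then 1 else 0) + srcCount A p := by simp [srcCount]

@[simp] lemma srcCount_append (A : Finset V) (p q : List (Step V E)) :
    srcCount A (p ++ q) = srcCount A p + srcCount A q := by simp [srcCount]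

@[simp] lemma tgtCount_nil (A : Finset V) : tgtCount A ([] : List (Step V E)) = 0 := by
  simp [tgtCount]

@[simp] lemma tgtCount_cons (A : Finset V) (s : Step V E) (p : List (Step V E)) :
    tgtCount A (s :: p) = (if s.tgt ∈ A then 1 else 0) + tgtCount A p := by simp [tgtCount]

@[simp] lemma tgtCount_append (A : Finset V) (p q : List (Step V E)) :
    tgtCount A (p ++ q) = tgtCount A p + tgtCount A q := by simp [tgtCount]

lemma srcCount_nonneg (A : Finset V) (p : List (Step V E)) : 0 ≤ srcCount A p := by
  rw [srcCount_eq_countP]; positivity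

lemma tgtCount_nonneg (A : Finset V) (p : List (Step V E)) : 0 ≤ tgtCount A p := by
  rw [tgtCount_eq_countP]; positivity

lemma one_le_srcCount {A : Finset V} {p : List (Step V E)} {s : Step V E} (hs : s ∈ p)
    (h : s.src ∈ A) : 1 ≤ srcCount A p := by
  rw [srcCount_eq_countP]
  exact_mod_cast List.countP_pos_iff.mpr ⟨s, hs, by simpa using h⟩

lemma one_le_tgtCount {A : Finset V} {p : List (Step V E)} {s : Step V E} (hs : s ∈ p)
    (h : s.tgt ∈ A) : 1 ≤ tgtCount A p := by
  rw [tgtCount_eq_countP]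
  exact_mod_cast List.countP_pos_iff.mpr ⟨s, hs, by simpa using h⟩

lemma bal_toFinset {p : List (Step V E)} (hp : (p.map Step.edge).Nodup)
    (hs : ∀ s ∈ p, IsStep G s) (x : V) :
    bal G M (p.map Step.edge).toFinset x = listBal M p x := by
  rw [bal, sum_edges_toFinset hp, listBal]
  congr 1
  refine List.map_congr_left fun s h => ?_
  rw [mult_step (hs s h)]

/-- If no step of `p` is inside `A`, the edges of `p` leaving `A` are counted by the ends of `p`
in `A`. -/
lemma cut_toFinset {p : List (Step V E)} (hp : (p.map Step.edge).Nodup)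
    (hs : ∀ s ∈ p, IsStep G s) {A : Finset V} (hA : ∀ s ∈ p, ¬ (s.src ∈ A ∧ s.tgt ∈ A)) :
    cut G (p.map Step.edge).toFinset A = srcCount A p + tgtCount A p := by
  rw [cut, sum_edges_toFinset hp, srcCount, tgtCount, ← List.sum_map_add]
  congr 1
  refine List.map_congr_left fun s h => ?_
  rw [crosses_step (hs s h)]
  have := hA s h
  by_cases h1 : s.src ∈ A <;> by_cases h2 : s.tgt ∈ A <;> simp_all [Xor]

namespace StructuredMatching

variable {f : V → ℕ} (D : StructuredMatching G f)

/-! ### The laminar family of blossoms -/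

lemma exists_child_superset {A B : Finset V} (hA : A ∈ D.𝔅.blossoms) (hAB : A ⊂ B) :
    ∃ C, D.𝔅.IsChild C B ∧ A ⊆ C := by
  obtain ⟨C, hAC, hC⟩ := (D.𝔅.blossoms.filter (· ⊂ B)).exists_le_maximal
    (a := A) (by simp [hA, hAB])
  have h1 := hC.prop
  rw [Finset.mem_filter] at h1
  refine ⟨C, ⟨h1.1, h1.2, fun A' hA' h2 h3 => ?_⟩, hAC⟩
  exact absurd (hC.le_of_ge (by simp [hA', h3]) h2.le) (not_le_of_gt h2)

lemma child_unique {A A' B : Finset V} {x : V} (hA : D.𝔅.IsChild A B) (hA' : D.𝔅.IsChild A' B)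
    (hx : x ∈ A) (hx' : x ∈ A') : A = A' := by
  by_contra hne
  rcases D.laminar A hA.1 A' hA'.1 with h | h | h
  · exact hA.2.2 A' hA'.1 (h.ssubset_of_ne hne) hA'.2.1
  · exact hA'.2.2 A hA.1 (h.ssubset_of_ne (Ne.symm hne)) hA.2.1
  · exact Finset.disjoint_left.mp h hx hx'

lemma sameNodeIn_mem_iff {A B : Finset V} {u v : V} (hA : D.𝔅.IsChild A B)
    (h : D.𝔅.SameNodeIn B u v) : u ∈ A ↔ v ∈ A := by
  rcases h with rfl | ⟨C, hC, hu, hv⟩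
  · rfl
  · constructor
    · intro h; rwa [D.child_unique hA hC h hu]
    · intro h; rwa [D.child_unique hA hC h hv]

lemma sameNodeIn_eq_iff {B : Finset V} {u v x : V} (hx : D.𝔅.IsAtomIn B x)
    (h : D.𝔅.SameNodeIn B u v) : u = x ↔ v = x := by
  rcases h with rfl | ⟨C, hC, hu, hv⟩
  · rfl
  · constructor
    · rintro rfl; exact absurd hu (hx C hC)
    · rintro rfl; exact absurd hv (hx C hC)

/-- The base vertex of a blossom is either the atom where its closed trail starts, or the base
vertex of the child where it starts. -/
lemma base_cases {B : Finset V} (hB : B ∈ D.𝔅.blossoms) {s : Step V E}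
    (hs : s ∈ (D.𝔅.cyc B).head?) :
    (D.𝔅.IsAtomIn B s.src ∧ D.𝔅.base B = s.src) ∨
    ∃ A, D.𝔅.IsChild A B ∧ s.src ∈ A ∧ D.𝔅.base B = D.𝔅.base A ∧ D.𝔅.η B = D.𝔅.η A := by
  have h := D.isBlossom B hB
  by_cases hat : D.𝔅.IsAtomIn B s.src
  · left
    obtain ⟨t, ht⟩ : ∃ t, t ∈ (D.𝔅.cyc B).getLast? := by
      rw [List.getLast?_eq_some_getLast h.ne_nil]; exact ⟨_, rfl⟩
    exact ⟨hat, (h.base_atom s hs t ht hat).1⟩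
  · right
    simp only [BlossomData.IsAtomIn, not_forall, not_not] at hat
    obtain ⟨A, hA, hsA⟩ := hat
    have := h.base_blossom s hs A hA hsA
    exact ⟨A, hA, hsA, this.1, this.2.1⟩

lemma exists_head {B : Finset V} (hB : B ∈ D.𝔅.blossoms) :
    ∃ s l, D.𝔅.cyc B = s :: l :=
  List.exists_cons_of_ne_nil (D.isBlossom B hB).ne_nil

lemma base_mem (B : Finset V) (hB : B ∈ D.𝔅.blossoms) : D.𝔅.base B ∈ B := by
  induction B using Finset.strongInduction with
  | H B ih =>
    obtain ⟨s, l, hc⟩ := D.exists_head hB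
    rcases D.base_cases hB (s := s) (by simp [hc]) with h | ⟨A, hA, -, h, -⟩
    · rw [h.2]
      exact ((D.isBlossom B hB).steps s (by simp [hc])).2.1
    · rw [h]
      exact hA.2.1.1 (ih A hA.2.1 hA.1)

/-- A child is the starting node of the closed trail exactly if it contains the base vertex. -/
lemma base_mem_child_iff {A B : Finset V} (hB : B ∈ D.𝔅.blossoms) (hA : D.𝔅.IsChild A B)
    {s : Step V E} (hs : s ∈ (D.𝔅.cyc B).head?) : D.𝔅.base B ∈ A ↔ s.src ∈ A := by
  rcases D.base_cases hB hs with h | ⟨C, hC, hsC, h, -⟩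
  · rw [h.2]
  · rw [h]
    have hb := D.base_mem C hC.1
    constructor
    · intro h; rwa [D.child_unique hA hC h hb]
    · intro h; rwa [D.child_unique hA hC h hsC]

/-- The child containing the base vertex of `B` has the base vertex and base edge of `B`. -/
lemma base_child {A B : Finset V} (hB : B ∈ D.𝔅.blossoms) (hA : D.𝔅.IsChild A B)
    (h : D.𝔅.base B ∈ A) : D.𝔅.base B = D.𝔅.base A ∧ D.𝔅.η B = D.𝔅.η A := by
  obtain ⟨s, l, hc⟩ := D.exists_head hB
  have hs : s ∈ (D.𝔅.cyc B).head? := by simp [hc]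
  have := (D.isBlossom B hB).base_blossom s hs A hA ((D.base_mem_child_iff hB hA hs).mp h)
  exact ⟨this.1, this.2.1⟩

/-- A child not containing the base vertex of `B` has its base edge on the closed trail. -/
lemma baseEdge_child {A B : Finset V} (hB : B ∈ D.𝔅.blossoms) (hA : D.𝔅.IsChild A B)
    (h : D.𝔅.base B ∉ A) : ∃ t ∈ D.𝔅.cyc B, D.𝔅.η A = some t.edge := by
  obtain ⟨s, l, hc⟩ := D.exists_head hB
  have hs : s ∈ (D.𝔅.cyc B).head? := by simp [hc]
  exact (D.isBlossom B hB).child_base_edge s hs A hA fun h' =>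
    h ((D.base_mem_child_iff hB hA hs).mpr h')

lemma baseEdge_crosses {B : Finset V} (hB : B ∈ D.𝔅.blossoms) {e : E} (he : D.𝔅.η B = some e) :
    Crosses G e B := by
  obtain ⟨⟨x, hx, hl⟩, -⟩ := (D.isBlossom B hB).base_edge e he
  exact ⟨_, _, hl, D.base_mem B hB, hx⟩

/-- The sign of the base edge of `B` (including the artificial one, which counts as matched). -/
noncomputable def baseSgn (B : Finset V) : ℤ := if D.𝔅.heavy B then 1 else -1

lemma sgn_baseEdge {B : Finset V} (hB : B ∈ D.𝔅.blossoms) {e : E} (he : D.𝔅.η B = some e) :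
    sgn D.edges e = D.baseSgn B := by
  have h := ((D.isBlossom B hB).base_edge e he).2
  unfold sgn baseSgn
  by_cases h1 : D.𝔅.heavy B <;> by_cases h2 : e ∈ D.edges <;> simp_all

/-- The base edge of `A` is a genuine edge belonging to `F`. -/
def HasBase (F : Finset E) (A : Finset V) : Prop := ∃ e ∈ F, D.𝔅.η A = some e

/-! ### Half of the closed trail of a blossom -/

lemma listBal_chain {B : Finset V} {x : V} (hx : D.𝔅.IsAtomIn B x) (p : List (Step V E)) :
    ∀ (s : Step V E), (s :: p).IsChain (fun s t => D.𝔅.SameNodeIn B s.tgt t.src) →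
    (s :: p).IsChain (fun s t => D.𝔅.IsAtomIn B s.tgt → OppType M s.edge t.edge) →
    ∀ t ∈ (s :: p).getLast?, listBal M (s :: p) x =
      sgn M s.edge * (if s.src = x then 1 else 0) +
        sgn M t.edge * (if t.tgt = x then 1 else 0) := by
  induction p with
  | nil =>
    intro s _ _ t ht
    simp only [List.getLast?_singleton, Option.mem_def, Option.some.injEq] at ht
    subst ht
    simp [mul_add]
  | cons s' p ih =>
    intro s h1 h2 t ht
    rw [List.isChain_cons_cons] at h1 h2
    rw [List.getLast?_cons_cons] at ht
    rw [listBal_cons, ih s' h1.2 h2.2 t ht]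
    have h3 := D.sameNodeIn_eq_iff hx h1.1
    by_cases h4 : s.tgt = x
    · have h5 := (h2.1 (by rw [h4]; exact hx)).sgn_eq
      rw [h5]
      simp only [h4, h3.mp h4, if_true]
      ring
    · have h5 : ¬ s'.src = x := fun h => h4 (h3.mpr h)
      simp only [h4, h5, if_false]
      ring

lemma count_chain {A B : Finset V} (hA : D.𝔅.IsChild A B) (p : List (Step V E)) :
    ∀ (s : Step V E), (s :: p).IsChain (fun s t => D.𝔅.SameNodeIn B s.tgt t.src) →
    ∀ t ∈ (s :: p).getLast?, tgtCount A (s :: p) + (if s.src ∈ A then 1 else 0) =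
      srcCount A (s :: p) + (if t.tgt ∈ A then 1 else 0) := by
  induction p with
  | nil =>
    intro s _ t ht
    simp only [List.getLast?_singleton, Option.mem_def, Option.some.injEq] at ht
    subst ht
    simp [add_comm]
  | cons s' p ih =>
    intro s h1 t ht
    rw [List.isChain_cons_cons] at h1
    rw [List.getLast?_cons_cons] at ht
    have h2 := ih s' h1.2 t ht
    have h3 := D.sameNodeIn_mem_iff hA h1.1
    rw [tgtCount_cons, srcCount_cons]
    simp only [h3] at *
    linarith

/-- At an atom, both end edges of the closed trail of a blossom have the sign opposite to the
base edge if the atom is the base vertex; otherwise they do not meet the atom there. -/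
lemma cyc_ends {B : Finset V} (hB : B ∈ D.𝔅.blossoms) {x : V} (hx : D.𝔅.IsAtomIn B x)
    {s t : Step V E} (hs : s ∈ (D.𝔅.cyc B).head?) (ht : t ∈ (D.𝔅.cyc B).getLast?) :
    sgn D.edges s.edge * (if s.src = x then 1 else 0) =
      -(D.baseSgn B * (if D.𝔅.base B = x then 1 else 0)) ∧
    sgn D.edges t.edge * (if t.tgt = x then 1 else 0) =
      -(D.baseSgn B * (if D.𝔅.base B = x then 1 else 0)) := by
  have h := D.isBlossom B hB
  have hst := D.sameNodeIn_eq_iff hx (h.closed s hs t ht)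
  have hbase : D.𝔅.base B = x ↔ s.src = x := by
    rcases D.base_cases hB hs with h | ⟨C, hC, hsC, h, -⟩
    · rw [h.2]
    · rw [h]
      constructor
      · rintro rfl; exact absurd (D.base_mem C hC.1) (hx C hC)
      · rintro rfl; exact absurd hsC (hx C hC)
  by_cases h1 : s.src = x
  · have h2 := h.base_atom s hs t ht (by rwa [h1])
    simp only [h1, hst.mpr h1, hbase.mpr h1, if_true, sgn, baseSgn, h2.2.1, h2.2.2]
    split_ifs <;> simp
  · have h2 : ¬ t.tgt = x := fun h' => h1 (hst.mp h')
    have h3 : ¬ D.𝔅.base B = x := fun h' => h1 (hbase.mp h')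
    simp [h1, h2, h3]

/-- For an entry of sign `ς` into the blossom `B` at the vertex `w`, a set `P` of edges of the
closed trail of `B` which, in the graph with the children of `B` contracted, leads from `w` to the
base vertex: together with the entry and the base edge of `B` it is balanced at the atoms, and at
each child it uses nothing, or the base edge of the child and one further entry. If `w` is in the
child where the closed trail starts, `P` is empty; otherwise `P` is one of the two parts into which
an occurrence of the node of `w` splits the closed trail. -/
lemma exists_cyc_part {B : Finset V} (hB : B ∈ D.𝔅.blossoms) {w : V} (hw : w ∈ B) {ς : ℤ}
    (hς : ς = 1 ∨ ς = -1) :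
    ∃ P : Finset E, (∀ e ∈ P, ∃ s ∈ D.𝔅.cyc B, s.edge = e) ∧
      (∀ x, D.𝔅.IsAtomIn B x → bal G D.edges P x =
        -(ς * (if w = x then 1 else 0)) - D.baseSgn B * (if D.𝔅.base B = x then 1 else 0)) ∧
      (∀ A, D.𝔅.IsChild A B → cut G P A + (if w ∈ A then 1 else 0) =
        2 * (if D.HasBase P A then 1 else 0) + (if D.𝔅.base B ∈ A then 1 else 0)) := by
  have h := D.isBlossom B hB
  obtain ⟨s₀, l, hc⟩ := D.exists_head hB
  have hs₀ : s₀ ∈ (D.𝔅.cyc B).head? := by simp [hc]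
  by_cases hroot : ∃ A, D.𝔅.IsChild A B ∧ w ∈ A ∧ s₀.src ∈ A
  · -- In the starting child no edge of the closed trail is needed.
    obtain ⟨A, hA, hwA, hsA⟩ := hroot
    have hb : D.𝔅.base B ∈ A := (D.base_mem_child_iff hB hA hs₀).mpr hsA
    refine ⟨∅, by simp, fun x hx => ?_, fun A' hA' => ?_⟩
    · have h1 : w ≠ x := by rintro rfl; exact hx A hA hwA
      have h2 : D.𝔅.base B ≠ x := by rintro rfl; exact hx A hA hb
      simp [bal, h1, h2]
    · have h1 : w ∈ A' ↔ D.𝔅.base B ∈ A' := by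
        constructor
        · intro h'; rwa [D.child_unique hA' hA h' hwA]
        · intro h'; rwa [D.child_unique hA' hA h' hb]
      simp [cut, HasBase, h1]
  obtain ⟨s, hs, hws⟩ := h.cover w hw
  obtain ⟨pre, post, hsplit⟩ := List.append_of_mem hs
  obtain ⟨t, ht⟩ : ∃ t, t ∈ (D.𝔅.cyc B).getLast? := by
    rw [List.getLast?_eq_some_getLast h.ne_nil]; exact ⟨_, rfl⟩
  have ht' : t ∈ (s :: post).getLast? := by
    rw [hsplit, List.getLast?_append] at ht
    cases h' : (s :: post).getLast? with
    | none => simp at h'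
    | some t' => simpa [h'] using ht
  have hnd := h.nodup
  rw [hsplit, List.map_append] at hnd
  have hnd1 : (pre.map Step.edge).Nodup := hnd.of_append_left
  have hnd2 : ((s :: post).map Step.edge).Nodup := hnd.of_append_right
  have hmem : ∀ u, u ∈ D.𝔅.cyc B ↔ u ∈ pre ∨ u ∈ s :: post := by
    intro u; rw [hsplit, List.mem_append]
  have hst1 : ∀ u ∈ pre, IsStep G u := fun u hu => (h.steps u ((hmem u).mpr (Or.inl hu))).1
  have hst2 : ∀ u ∈ s :: post, IsStep G u := fun u hu => (h.steps u ((hmem u).mpr (Or.inr hu))).1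
  have hch := h.chain
  have halt := h.alternating
  have hsuf : ∀ x, D.𝔅.IsAtomIn B x → bal G D.edges ((s :: post).map Step.edge).toFinset x =
      sgn D.edges s.edge * (if s.src = x then 1 else 0) -
        D.baseSgn B * (if D.𝔅.base B = x then 1 else 0) := by
    intro x hx
    rw [hsplit] at hch halt
    rw [bal_toFinset hnd2 hst2, D.listBal_chain hx post s (hch.right_of_append)
      (halt.right_of_append) t ht', (D.cyc_ends hB hx hs₀ ht).2]
    ring
  have hpre : ∀ x, D.𝔅.IsAtomIn B x → bal G D.edges (pre.map Step.edge).toFinset x =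
      -(sgn D.edges s.edge * (if s.src = x then 1 else 0)) -
        D.baseSgn B * (if D.𝔅.base B = x then 1 else 0) := by
    intro x hx
    have h1 := hsuf x hx
    rw [bal_toFinset hnd2 hst2] at h1
    rw [hc] at hch halt ht
    have h2 := D.listBal_chain hx l s₀ hch halt t ht
    rw [← hc] at h2 ht
    rw [(D.cyc_ends hB hx hs₀ ht).1, (D.cyc_ends hB hx hs₀ ht).2, hsplit, listBal_append] at h2
    rw [bal_toFinset hnd1 hst1]
    linarith
  -- The counting facts at a child `A`.
  have hcount : ∀ A, D.𝔅.IsChild A B →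
      (srcCount A pre + srcCount A (s :: post) = 1 ∧ tgtCount A pre + tgtCount A (s :: post) = 1 ∧
      tgtCount A (s :: post) + (if w ∈ A then 1 else 0) =
        srcCount A (s :: post) + (if D.𝔅.base B ∈ A then 1 else 0)) ∧
      cut G (pre.map Step.edge).toFinset A = srcCount A pre + tgtCount A pre ∧
      cut G ((s :: post).map Step.edge).toFinset A =
        srcCount A (s :: post) + tgtCount A (s :: post) := by
    intro A hA
    have h1 := D.base_mem_child_iff hB hA hs₀
    have h2 := D.sameNodeIn_mem_iff hA hws
    have h3 := D.sameNodeIn_mem_iff hA (h.closed s₀ hs₀ t ht)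
    have hch' := hch
    rw [hsplit] at hch
    have h4 := D.count_chain hA post s hch.right_of_append t ht'
    have ht₂ := ht
    rw [hc] at hch' ht₂
    have h5 := D.count_chain hA l s₀ hch' t ht₂
    rw [← hc] at h5
    have h6 : (srcCount A (D.𝔅.cyc B) + tgtCount A (D.𝔅.cyc B) : ℤ) = 2 := by
      rw [srcCount_eq_countP, tgtCount_eq_countP]
      exact_mod_cast h.degree_two A hA
    rw [hsplit, srcCount_append, tgtCount_append] at h5 h6
    simp only [h1, h2, h3] at *
    refine ⟨⟨by omega, by omega, by omega⟩, ?_, ?_⟩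
    · exact cut_toFinset hnd1 hst1 fun u hu => h.not_internal u ((hmem u).mpr (Or.inl hu)) A hA
    · exact cut_toFinset hnd2 hst2 fun u hu => h.not_internal u ((hmem u).mpr (Or.inr hu)) A hA
  -- The part holding the base edge of a child holds an end in the child.
  have hbase : ∀ A, D.𝔅.IsChild A B → D.𝔅.base B ∉ A → ∀ p : List (Step V E),
      (∀ u ∈ p, IsStep G u) → D.HasBase (p.map Step.edge).toFinset A →
      1 ≤ srcCount A p + tgtCount A p := by
    rintro A hA hbA p hp ⟨e, he, hη⟩
    simp only [List.mem_toFinset, List.mem_map] at he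
    obtain ⟨u, hu, rfl⟩ := he
    have h1 := srcCount_nonneg A p
    have h2 := tgtCount_nonneg A p
    rcases (crosses_step (hp u hu) A).mp (D.baseEdge_crosses hA.1 hη) with h' | h'
    · have := one_le_srcCount hu h'.1; omega
    · have := one_le_tgtCount hu h'.1; omega
  have hone : ∀ A, D.𝔅.IsChild A B → D.𝔅.base B ∉ A →
      D.HasBase (pre.map Step.edge).toFinset A ∨
      D.HasBase ((s :: post).map Step.edge).toFinset A := by
    intro A hA hbA
    obtain ⟨u, hu, hη⟩ := D.baseEdge_child hB hA hbA
    rcases (hmem u).mp hu with hu | hu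
    · exact Or.inl ⟨u.edge, by simp only [List.mem_toFinset]; exact List.mem_map_of_mem hu, hη⟩
    · exact Or.inr ⟨u.edge, by simp only [List.mem_toFinset]; exact List.mem_map_of_mem hu, hη⟩
  -- The base edge of the starting child leaves `B`, so it is in neither part.
  have hnone : ∀ A, D.𝔅.IsChild A B → D.𝔅.base B ∈ A → ∀ p : List (Step V E),
      (∀ u ∈ p, u ∈ D.𝔅.cyc B) → ¬ D.HasBase (p.map Step.edge).toFinset A := by
    rintro A hA hbA p hp ⟨e, he, hη⟩
    simp only [List.mem_toFinset, List.mem_map] at he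
    obtain ⟨u, hu, rfl⟩ := he
    rw [← (D.base_child hB hA hbA).2] at hη
    obtain ⟨h1, h2, h3⟩ := h.steps u (hp u hu)
    rcases (crosses_step h1 B).mp (D.baseEdge_crosses hB hη) with h' | h'
    · exact h'.2 h3
    · exact h'.2 h2
  have hmem1 : ∀ e ∈ (pre.map Step.edge).toFinset, ∃ s ∈ D.𝔅.cyc B, s.edge = e := by
    intro e he
    simp only [List.mem_toFinset, List.mem_map] at he
    obtain ⟨u, hu, rfl⟩ := he
    exact ⟨u, (hmem u).mpr (Or.inl hu), rfl⟩
  have hmem2 : ∀ e ∈ ((s :: post).map Step.edge).toFinset, ∃ s ∈ D.𝔅.cyc B, s.edge = e := by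
    intro e he
    rw [List.mem_toFinset, List.mem_map] at he
    obtain ⟨u, hu, rfl⟩ := he
    exact ⟨u, (hmem u).mpr (Or.inr hu), rfl⟩
  -- The cut formula for a part `p` with complement `q`. At the child of `w` it needs that the part
  -- with the base edge of this child has been chosen.
  have hcut : ∀ p q : List (Step V E), (∀ u ∈ p, u ∈ D.𝔅.cyc B) → (∀ u ∈ q, u ∈ D.𝔅.cyc B) →
      ∀ A, D.𝔅.IsChild A B →
      srcCount A p + srcCount A q = 1 → tgtCount A p + tgtCount A q = 1 →
      (tgtCount A p + (if w ∈ A then 1 else 0) =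
          srcCount A p + (if D.𝔅.base B ∈ A then 1 else 0) ∨
        tgtCount A p + (if D.𝔅.base B ∈ A then 1 else 0) =
          srcCount A p + (if w ∈ A then 1 else 0)) →
      (D.𝔅.base B ∉ A → D.HasBase (p.map Step.edge).toFinset A ∨
        D.HasBase (q.map Step.edge).toFinset A) →
      (w ∈ A → D.HasBase (p.map Step.edge).toFinset A) →
      srcCount A p + tgtCount A p + (if w ∈ A then 1 else 0) =
        2 * (if D.HasBase (p.map Step.edge).toFinset A then 1 else 0) +
          (if D.𝔅.base B ∈ A then 1 else 0) := by
    intro p q hp hq A hA c1 c2 c3 hor hwp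
    have n1 := srcCount_nonneg A p
    have n2 := tgtCount_nonneg A p
    have n3 := srcCount_nonneg A q
    have n4 := tgtCount_nonneg A q
    by_cases hwA : w ∈ A
    · have hbA : D.𝔅.base B ∉ A := fun hbA =>
        hroot ⟨A, hA, hwA, (D.base_mem_child_iff hB hA hs₀).mp hbA⟩
      simp only [hwA, hbA, hwp hwA, if_true, if_false] at c3 ⊢
      omega
    · by_cases hbA : D.𝔅.base B ∈ A
      · have := hnone A hA hbA p hp
        simp only [hwA, hbA, this, if_true, if_false] at c3 ⊢
        omega
      · have b1 := hbase A hA hbA p fun u hu => (h.steps u (hp u hu)).1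
        have b2 := hbase A hA hbA q fun u hu => (h.steps u (hq u hu)).1
        have b3 := hor hbA
        simp only [hwA, hbA, if_false] at c3 ⊢
        split_ifs with hh
        · have := b1 hh; omega
        · have := b2 (b3.resolve_left hh); omega
  have hpre_mem : ∀ u ∈ pre, u ∈ D.𝔅.cyc B := fun u hu => (hmem u).mpr (Or.inl hu)
  have hsuf_mem : ∀ u ∈ s :: post, u ∈ D.𝔅.cyc B := fun u hu => (hmem u).mpr (Or.inr hu)
  have hsufcut : ∀ A, D.𝔅.IsChild A B →
      (w ∈ A → D.HasBase ((s :: post).map Step.edge).toFinset A) →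
      cut G ((s :: post).map Step.edge).toFinset A + (if w ∈ A then 1 else 0) =
        2 * (if D.HasBase ((s :: post).map Step.edge).toFinset A then 1 else 0) +
          (if D.𝔅.base B ∈ A then 1 else 0) := by
    intro A hA hch
    obtain ⟨⟨c1, c2, c3⟩, -, c5⟩ := hcount A hA
    rw [c5]
    exact hcut _ _ hsuf_mem hpre_mem A hA (by omega) (by omega) (Or.inl c3)
      (fun hb => (hone A hA hb).symm) hch
  have hprecut : ∀ A, D.𝔅.IsChild A B →
      (w ∈ A → D.HasBase (pre.map Step.edge).toFinset A) →
      cut G (pre.map Step.edge).toFinset A + (if w ∈ A then 1 else 0) =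
        2 * (if D.HasBase (pre.map Step.edge).toFinset A then 1 else 0) +
          (if D.𝔅.base B ∈ A then 1 else 0) := by
    intro A hA hch
    obtain ⟨⟨c1, c2, c3⟩, c4, -⟩ := hcount A hA
    rw [c4]
    exact hcut _ _ hpre_mem hsuf_mem A hA c1 c2 (Or.inr (by omega)) (hone A hA) hch
  by_cases hwat : D.𝔅.IsAtomIn B w
  · -- At an atom, the part is chosen by its first sign at `w`.
    have hwA : ∀ A, D.𝔅.IsChild A B → w ∉ A := fun A hA => hwat A hA
    have hsw : s.src = w := (D.sameNodeIn_eq_iff hwat hws).mp rfl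
    by_cases hsg : sgn D.edges s.edge = -ς
    · refine ⟨_, hmem2, fun x hx => ?_, fun A hA => hsufcut A hA fun h' => absurd h' (hwA A hA)⟩
      rw [hsuf x hx, hsw, hsg]; ring
    · refine ⟨_, hmem1, fun x hx => ?_, fun A hA => hprecut A hA fun h' => absurd h' (hwA A hA)⟩
      have : sgn D.edges s.edge = ς := by
        rcases sgn_cases D.edges s.edge with h' | h' <;> omega
      rw [hpre x hx, hsw, this]
  · -- In a child, the part is the one holding the base edge of the child.
    simp only [BlossomData.IsAtomIn, not_forall, not_not] at hwat
    obtain ⟨C, hC, hwC⟩ := hwat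
    have hwx : ∀ x, D.𝔅.IsAtomIn B x → w ≠ x ∧ s.src ≠ x := by
      intro x hx
      have : s.src ∈ C := (D.sameNodeIn_mem_iff hC hws).mp hwC
      exact ⟨by rintro rfl; exact hx C hC hwC, by rintro rfl; exact hx C hC this⟩
    have hbC : D.𝔅.base B ∉ C := fun hbC =>
      hroot ⟨C, hC, hwC, (D.base_mem_child_iff hB hC hs₀).mp hbC⟩
    rcases hone C hC hbC with hh | hh
    · refine ⟨_, hmem1, fun x hx => ?_, fun A hA => hprecut A hA fun h' => ?_⟩
      · rw [hpre x hx]; simp [(hwx x hx).1, (hwx x hx).2]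
      · rwa [D.child_unique hA hC h' hwC]
    · refine ⟨_, hmem2, fun x hx => ?_, fun A hA => hsufcut A hA fun h' => ?_⟩
      · rw [hsuf x hx]; simp [(hwx x hx).1, (hwx x hx).2]
      · rwa [D.child_unique hA hC h' hwC]

end StructuredMatching

/-! ### Expanding the blossoms of a contracted trail -/

lemma exists_mult_eq_of_crosses {e : E} {A : Finset V} (h : Crosses G e A) :
    ∃ w ∈ A, ∀ x ∈ A, mult G e x = if w = x then 1 else 0 := by
  obtain ⟨w, y, hl, hw, hy⟩ := h
  refine ⟨w, hw, fun x hx => ?_⟩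
  have h1 := mult_step (G := G) (s := ⟨w, e, y⟩) hl x
  have h2 : y ≠ x := by rintro rfl; exact hy hx
  simpa [h2] using h1

lemma ends_notMem_of_not_crosses {s : Step V E} (hs : IsStep G s) {A : Finset V}
    (hc : ¬ Crosses G s.edge A) (hin : ¬ (s.src ∈ A ∧ s.tgt ∈ A)) : s.src ∉ A ∧ s.tgt ∉ A := by
  rw [crosses_step hs] at hc
  constructor
  · intro h; apply hc; left; exact ⟨h, fun h' => hin ⟨h, h'⟩⟩
  · intro h; apply hc; right; exact ⟨h, fun h' => hin ⟨h', h⟩⟩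

/-- If no edge of `F` is inside `A`, only the edges of `F` leaving `A` count at vertices of `A`. -/
lemma sum_mult_eq_sum_crosses {F : Finset E} {A : Finset V} (hF : ∀ e ∈ F, e ∈ E(G))
    (hin : ∀ s, IsStep G s → s.edge ∈ F → ¬ (s.src ∈ A ∧ s.tgt ∈ A)) (g : E → ℤ) {x : V}
    (hx : x ∈ A) :
    ∑ e ∈ F, g e * mult G e x = ∑ e ∈ F with Crosses G e A, g e * mult G e x := by
  rw [Finset.sum_filter]
  refine Finset.sum_congr rfl fun e he => ?_
  split_ifs with hc
  · rfl
  · obtain ⟨s, hs, rfl⟩ := exists_step (hF e he)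
    obtain ⟨h2, h3⟩ := ends_notMem_of_not_crosses hs hc (hin s hs he)
    have h4 : s.src ≠ x := by rintro rfl; exact h2 hx
    have h5 : s.tgt ≠ x := by rintro rfl; exact h3 hx
    rw [mult_step hs]
    simp [h4, h5]

/-- If no edge of `F` is inside `A`, the edges leaving `A` are counted by their ends in `A`. -/
lemma cut_eq_sum_mult {F : Finset E} {A : Finset V} (hF : ∀ e ∈ F, e ∈ E(G))
    (hin : ∀ s, IsStep G s → s.edge ∈ F → ¬ (s.src ∈ A ∧ s.tgt ∈ A)) :
    cut G F A = ∑ x ∈ A, ∑ e ∈ F, mult G e x := by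
  rw [cut, Finset.sum_comm]
  refine Finset.sum_congr rfl fun e he => ?_
  obtain ⟨s, hs, rfl⟩ := exists_step (hF e he)
  rw [sum_mult_step hs, crosses_step hs]
  have h1 := hin s hs he
  by_cases h2 : s.src ∈ A <;> by_cases h3 : s.tgt ∈ A <;> simp_all [Xor]

lemma bal_eq_zero_of_inside {P : Finset E} {A : Finset V}
    (hP : ∀ e ∈ P, ∃ s, IsStep G s ∧ s.edge = e ∧ s.src ∈ A ∧ s.tgt ∈ A) {x : V} (hx : x ∉ A) :
    bal G M P x = 0 := by
  refine Finset.sum_eq_zero fun e he => ?_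
  obtain ⟨s, hs, rfl, h1, h2⟩ := hP e he
  have h3 : s.src ≠ x := by rintro rfl; exact hx h1
  have h4 : s.tgt ≠ x := by rintro rfl; exact hx h2
  rw [mult_step hs]
  simp [h3, h4]

namespace StructuredMatching

variable {f : V → ℕ} (D : StructuredMatching G f)

/-- The edge set `F` of a trail with the ends `r` and `r'`, in the graph in which the blossoms of
`U` are still contracted. It is tight and balanced, has no edges inside contracted blossoms, and
at every blossom that is not properly inside a contracted one, it uses nothing, or the base edge
and one more edge, or one edge if the blossom contains an end of the trail. -/
structure IsPartialTrail (r r' : V) (F : Finset E) (U : Finset (Finset V)) : Prop where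
  blossom : ∀ A ∈ U, A ∈ D.𝔅.blossoms
  down : ∀ A ∈ U, ∀ A' ∈ D.𝔅.blossoms, A' ⊂ A → A' ∈ U
  edge_mem : ∀ e ∈ F, e ∈ E(G)
  tight : ∀ s, IsStep G s → s.edge ∈ F → D.Tight s
  cyc_tight : ∀ A ∈ U, ∀ s, IsStep G s → (∃ t ∈ D.𝔅.cyc A, t.edge = s.edge) → D.Tight s
  bal_eq : ∀ x, (∀ A ∈ U, x ∉ A) →
    bal G D.edges F x = (if r = x then 1 else 0) + (if r' = x then 1 else 0)
  cut_eq : ∀ A ∈ D.𝔅.blossoms, (∀ A' ∈ U, ¬ A ⊂ A') →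
    cut G F A = 2 * (if D.HasBase F A then 1 else 0) +
      ((if r ∈ A then 1 else 0) + (if r' ∈ A then 1 else 0))
  not_inside : ∀ A ∈ U, ∀ s, IsStep G s → s.edge ∈ F → ¬ (s.src ∈ A ∧ s.tgt ∈ A)

variable {D} {r r' : V} {F : Finset E} {U : Finset (Finset V)}

/-- A partial trail either avoids a maximal contracted blossom `A`, or it has just one end `w` in
`A` besides the base edge (which is in `F` or is the artificial one). -/
lemma IsPartialTrail.entry_cases (h : D.IsPartialTrail r r' F U)
    (hr : ∀ A ∈ D.𝔅.blossoms, r ∈ A → D.𝔅.base A = r ∧ D.𝔅.η A = none)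
    (hr' : ∀ A ∈ D.𝔅.blossoms, r' ∈ A → D.𝔅.base A = r' ∧ D.𝔅.η A = none)
    (hclosed : r = r' → 2 ≤ D.deficiency r) {A : Finset V} (hA : A ∈ U)
    (hmax : ∀ A' ∈ U, ¬ A ⊂ A') :
    (cut G F A = 0 ∧ r ∉ A ∧ r' ∉ A) ∨
    ∃ w ∈ A, ∃ ς : ℤ, (ς = 1 ∨ ς = -1) ∧
      (∀ x ∈ A, bal G D.edges F x = ((if r = x then 1 else 0) + (if r' = x then 1 else 0)) +
        ς * (if w = x then 1 else 0) + D.baseSgn A * (if D.𝔅.base A = x then 1 else 0)) ∧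
      (∀ x ∈ A, ∑ e ∈ F, mult G e x + ((if r = x then 1 else 0) + (if r' = x then 1 else 0)) =
        (if w = x then 1 else 0) + (if D.𝔅.base A = x then 1 else 0)) ∧
      ((D.HasBase F A ∧ r ∉ A ∧ r' ∉ A) ∨
        (D.𝔅.η A = none ∧ (r = D.𝔅.base A ∧ r' ∉ A ∨ r' = D.𝔅.base A ∧ r ∉ A))) := by
  have hAb := h.blossom A hA
  have hcut := h.cut_eq A hAb hmax
  have hcard : cut G F A = ((F.filter fun e => Crosses G e A).card : ℤ) := by
    rw [cut, Finset.card_filter]; push_cast; rfl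
  have hsum := fun g x (hx : x ∈ A) =>
    sum_mult_eq_sum_crosses h.edge_mem (h.not_inside A hA) g (x := x) hx
  have hnotboth : ¬ (r ∈ A ∧ r' ∈ A) := by
    rintro ⟨h1, h2⟩
    have h3 := hr A hAb h1
    have h4 : r = r' := h3.1.symm.trans (hr' A hAb h2).1
    have h5 := (D.isBlossom A hAb).free_light (((D.isBlossom A hAb).artificial_iff).mp h3.2)
    have h6 := hclosed h4
    rw [h3.1] at h5
    omega
  by_cases hη : D.HasBase F A
  · have hrA : r ∉ A := by
      intro h'; obtain ⟨e, -, he⟩ := hη; simp [(hr A hAb h').2] at he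
    have hrA' : r' ∉ A := by
      intro h'; obtain ⟨e, -, he⟩ := hη; simp [(hr' A hAb h').2] at he
    right
    rw [hcard] at hcut
    simp only [hη, hrA, hrA', if_true, if_false] at hcut
    obtain ⟨e, heF, heη⟩ := hη
    have heQ : e ∈ F.filter fun e => Crosses G e A :=
      Finset.mem_filter.mpr ⟨heF, D.baseEdge_crosses hAb heη⟩
    have hc1 : ((F.filter fun e => Crosses G e A).erase e).card = 1 := by
      rw [Finset.card_erase_of_mem heQ]; omega
    obtain ⟨e', he'⟩ := Finset.card_eq_one.mp hc1
    have he'Q : e' ∈ (F.filter fun e => Crosses G e A).erase e := by rw [he']; simp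
    have he'c := (Finset.mem_filter.mp (Finset.mem_of_mem_erase he'Q)).2
    obtain ⟨w, hw, hmw⟩ := exists_mult_eq_of_crosses he'c
    have hmb : ∀ x ∈ A, mult G e x = if D.𝔅.base A = x then 1 else 0 := by
      obtain ⟨⟨y, hy, hl⟩, -⟩ := (D.isBlossom A hAb).base_edge e heη
      intro x hx
      have h1 := mult_step (G := G) (s := ⟨D.𝔅.base A, e, y⟩) hl x
      have h2 : y ≠ x := by rintro rfl; exact hy hx
      simpa [h2] using h1
    have hsum' : ∀ (g : E → ℤ), ∀ x ∈ A, ∑ e ∈ F, g e * mult G e x =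
        g e' * (if w = x then 1 else 0) + g e * (if D.𝔅.base A = x then 1 else 0) := by
      intro g x hx
      rw [hsum g x hx, ← Finset.sum_erase_add _ _ heQ, he', Finset.sum_singleton, hmw x hx,
        hmb x hx]
    have hrx : ∀ x ∈ A, r ≠ x ∧ r' ≠ x := fun x hx =>
      ⟨by rintro rfl; exact hrA hx, by rintro rfl; exact hrA' hx⟩
    refine ⟨w, hw, sgn D.edges e', sgn_cases _ _, fun x hx => ?_, fun x hx => ?_,
      Or.inl ⟨⟨e, heF, heη⟩, hrA, hrA'⟩⟩
    · rw [bal, hsum' _ x hx, D.sgn_baseEdge hAb heη]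
      simp [hrx x hx]
    · have := hsum' (fun _ => 1) x hx
      simp only [one_mul] at this
      rw [this]
      simp [hrx x hx]
  · by_cases hends : r ∈ A ∨ r' ∈ A
    · right
      have hfree : D.𝔅.η A = none ∧
          (r = D.𝔅.base A ∧ r' ∉ A ∨ r' = D.𝔅.base A ∧ r ∉ A) := by
        rcases hends with h1 | h1
        · exact ⟨(hr A hAb h1).2, Or.inl ⟨(hr A hAb h1).1.symm, fun h2 => hnotboth ⟨h1, h2⟩⟩⟩
        · exact ⟨(hr' A hAb h1).2, Or.inr ⟨(hr' A hAb h1).1.symm, fun h2 => hnotboth ⟨h2, h1⟩⟩⟩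
      have hbA := D.base_mem A hAb
      have hends1 : ∀ x ∈ A, ((if r = x then 1 else 0) + (if r' = x then 1 else 0) : ℤ) =
          if D.𝔅.base A = x then 1 else 0 := by
        intro x hx
        rcases hfree.2 with ⟨h1, h2⟩ | ⟨h1, h2⟩
        · have : r' ≠ x := by rintro rfl; exact h2 hx
          simp [h1, this]
        · have : r ≠ x := by rintro rfl; exact h2 hx
          simp [h1, this]
      have hends2 : ((if r ∈ A then 1 else 0) + (if r' ∈ A then 1 else 0) : ℤ) = 1 := by
        rcases hfree.2 with ⟨h1, h2⟩ | ⟨h1, h2⟩ <;> simp [h1, h2, hbA]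
      have hlight : D.baseSgn A = -1 := by
        have := (D.isBlossom A hAb).free_light (((D.isBlossom A hAb).artificial_iff).mp hfree.1)
        simp [baseSgn, this.1]
      rw [hcard, hends2] at hcut
      simp only [hη, if_false] at hcut
      have hc1 : (F.filter fun e => Crosses G e A).card = 1 := by omega
      obtain ⟨e', he'⟩ := Finset.card_eq_one.mp hc1
      have he'Q : e' ∈ F.filter fun e => Crosses G e A := by rw [he']; simp
      obtain ⟨w, hw, hmw⟩ := exists_mult_eq_of_crosses (Finset.mem_filter.mp he'Q).2
      have hsum' : ∀ (g : E → ℤ), ∀ x ∈ A, ∑ e ∈ F, g e * mult G e x =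
          g e' * (if w = x then 1 else 0) := by
        intro g x hx
        rw [hsum g x hx, he', Finset.sum_singleton, hmw x hx]
      refine ⟨w, hw, sgn D.edges e', sgn_cases _ _, fun x hx => ?_, fun x hx => ?_, Or.inr hfree⟩
      · rw [bal, hsum' _ x hx, hends1 x hx, hlight]
        ring
      · have := hsum' (fun _ => 1) x hx
        simp only [one_mul] at this
        rw [this, hends1 x hx]
    · left
      push Not at hends
      simp only [hη, hends.1, hends.2, if_false] at hcut
      exact ⟨by simpa using hcut, hends⟩

lemma cut_eq_zero_iff {F : Finset E} {A : Finset V} :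
    cut G F A = 0 ↔ ∀ e ∈ F, ¬ Crosses G e A := by
  rw [cut, Finset.sum_eq_zero_iff_of_nonneg fun e _ => by split_ifs <;> simp]
  refine forall₂_congr fun e _ => ?_
  split_ifs with h <;> simp [h]

/-- A maximal contracted blossom can be expanded. -/
lemma IsPartialTrail.expand (h : D.IsPartialTrail r r' F U)
    (hr : ∀ A ∈ D.𝔅.blossoms, r ∈ A → D.𝔅.base A = r ∧ D.𝔅.η A = none)
    (hr' : ∀ A ∈ D.𝔅.blossoms, r' ∈ A → D.𝔅.base A = r' ∧ D.𝔅.η A = none)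
    (hclosed : r = r' → 2 ≤ D.deficiency r) {A : Finset V} (hA : A ∈ U)
    (hmax : ∀ A' ∈ U, ¬ A ⊂ A') :
    ∃ F', D.IsPartialTrail r r' F' (U.erase A) := by
  have hAb := h.blossom A hA
  have hB := D.isBlossom A hAb
  have hdown : ∀ C ∈ U.erase A, ∀ A' ∈ D.𝔅.blossoms, A' ⊂ C → A' ∈ U.erase A := by
    intro C hC A' hA' hsub
    have hCU := Finset.mem_of_mem_erase hC
    refine Finset.mem_erase.mpr ⟨?_, h.down C hCU A' hA' hsub⟩
    rintro rfl
    exact hmax C hCU hsub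
  -- the blossoms that are newly covered by the cut formula are the children of `A`
  have hnew : ∀ A' ∈ D.𝔅.blossoms, (∀ C ∈ U.erase A, ¬ A' ⊂ C) → A' ⊂ A → D.𝔅.IsChild A' A := by
    intro A' hA' h1 h2
    exact ⟨hA', h2, fun C hC h3 h4 => h1 C (Finset.mem_erase.mpr ⟨h4.ne, h.down A hA C hC h4⟩) h3⟩
  have hold : ∀ A' ∈ D.𝔅.blossoms, (∀ C ∈ U.erase A, ¬ A' ⊂ C) → ¬ A' ⊂ A →
      ∀ C ∈ U, ¬ A' ⊂ C := by
    intro A' _ h1 h2 C hC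
    by_cases hCA : C = A
    · rwa [hCA]
    · exact h1 C (Finset.mem_erase.mpr ⟨hCA, hC⟩)
  have hatom : ∀ x, (∀ C ∈ U.erase A, x ∉ C) → D.𝔅.IsAtomIn A x := fun x hx C hC =>
    hx C (Finset.mem_erase.mpr ⟨hC.2.1.ne, h.down A hA C hC.1 hC.2.1⟩)
  have hout : ∀ x, (∀ C ∈ U.erase A, x ∉ C) → x ∉ A → ∀ C ∈ U, x ∉ C := by
    intro x hx hxA C hC
    by_cases hCA : C = A
    · rwa [hCA]
    · exact hx C (Finset.mem_erase.mpr ⟨hCA, hC⟩)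
  rcases h.entry_cases hr hr' hclosed hA hmax with ⟨hc0, hrA, hrA'⟩ |
    ⟨w, hw, ς, hς, hbal, hdeg, hbase⟩
  · -- The trail avoids `A`.
    have hend : ∀ s, IsStep G s → s.edge ∈ F → s.src ∉ A ∧ s.tgt ∉ A := by
      intro s hs hsF
      exact ends_notMem_of_not_crosses hs (cut_eq_zero_iff.mp hc0 s.edge hsF)
        (h.not_inside A hA s hs hsF)
    refine ⟨F, ⟨fun C hC => h.blossom C (Finset.mem_of_mem_erase hC), hdown, h.edge_mem, h.tight,
      fun C hC => h.cyc_tight C (Finset.mem_of_mem_erase hC), fun x hx => ?_,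
      fun A' hA' hmax' => ?_, fun C hC => h.not_inside C (Finset.mem_of_mem_erase hC)⟩⟩
    · by_cases hxA : x ∈ A
      · have h1 : r ≠ x := by rintro rfl; exact hrA hxA
        have h2 : r' ≠ x := by rintro rfl; exact hrA' hxA
        simp only [h1, h2, if_false, add_zero]
        refine Finset.sum_eq_zero fun e he => ?_
        obtain ⟨s, hs, rfl⟩ := exists_step (h.edge_mem e he)
        have h3 := hend s hs he
        have h4 : s.src ≠ x := by rintro rfl; exact h3.1 hxA
        have h5 : s.tgt ≠ x := by rintro rfl; exact h3.2 hxA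
        rw [mult_step hs]
        simp [h4, h5]
      · exact h.bal_eq x (hout x hx hxA)
    · by_cases hsub : A' ⊂ A
      · have h1 : r ∉ A' := fun h' => hrA (hsub.1 h')
        have h2 : r' ∉ A' := fun h' => hrA' (hsub.1 h')
        have h3 : ∀ e ∈ F, ¬ Crosses G e A' := by
          intro e he hcr
          obtain ⟨s, hs, rfl⟩ := exists_step (h.edge_mem e he)
          have h3 := hend s hs he
          rcases (crosses_step hs A').mp hcr with h' | h'
          · exact h3.1 (hsub.1 h'.1)
          · exact h3.2 (hsub.1 h'.1)
        have h4 : ¬ D.HasBase F A' := by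
          rintro ⟨e, he, hη⟩
          exact h3 e he (D.baseEdge_crosses hA' hη)
        rw [cut_eq_zero_iff.mpr h3]
        simp [h1, h2, h4]
      · exact h.cut_eq A' hA' (hold A' hA' hmax' hsub)
  -- The trail is continued inside `A` by a part of the closed trail of `A`.
  obtain ⟨P, hP, hPbal, hPcut⟩ := D.exists_cyc_part hAb hw hς
  have hPin : ∀ e ∈ P, ∃ s, IsStep G s ∧ s.edge = e ∧ s.src ∈ A ∧ s.tgt ∈ A := by
    intro e he
    obtain ⟨s, hs, rfl⟩ := hP e he
    obtain ⟨h1, h2, h3⟩ := hB.steps s hs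
    exact ⟨s, h1, rfl, h2, h3⟩
  have hdisj : Disjoint F P := by
    rw [Finset.disjoint_left]
    intro e heF heP
    obtain ⟨s, hs, rfl, h1⟩ := hPin e heP
    exact h.not_inside A hA s hs heF h1
  have hcutU : ∀ C, cut G (F ∪ P) C = cut G F C + cut G P C := fun C =>
    Finset.sum_union hdisj
  have hbaseU : ∀ C, D.HasBase (F ∪ P) C ↔ D.HasBase F C ∨ D.HasBase P C := by
    intro C
    simp only [HasBase, Finset.mem_union, or_and_right, exists_or]
  have hPcross : ∀ C, A ⊆ C ∨ Disjoint A C → ∀ e ∈ P, ¬ Crosses G e C := by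
    intro C hC e he hcr
    obtain ⟨s, hs, rfl, h1, h2⟩ := hPin e he
    rcases hC with hC | hC
    · rcases (crosses_step hs C).mp hcr with h' | h'
      · exact h'.2 (hC h2)
      · exact h'.2 (hC h1)
    · rcases (crosses_step hs C).mp hcr with h' | h'
      · exact Finset.disjoint_left.mp hC h1 h'.1
      · exact Finset.disjoint_left.mp hC h2 h'.1
  refine ⟨F ∪ P, ⟨fun C hC => h.blossom C (Finset.mem_of_mem_erase hC), hdown, fun e he => ?_,
    fun s hs hsF => ?_, fun C hC => h.cyc_tight C (Finset.mem_of_mem_erase hC), fun x hx => ?_,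
    fun A' hA' hmax' => ?_, fun C hC s hs hsF hin => ?_⟩⟩
  · rcases Finset.mem_union.mp he with he | he
    · exact h.edge_mem e he
    · obtain ⟨s, hs, rfl, -⟩ := hPin e he
      exact hs.mem_edgeSet
  · rcases Finset.mem_union.mp hsF with he | he
    · exact h.tight s hs he
    · exact h.cyc_tight A hA s hs (hP _ he)
  · have h1 : bal G D.edges (F ∪ P) x = bal G D.edges F x + bal G D.edges P x :=
      Finset.sum_union hdisj
    rw [h1]
    by_cases hxA : x ∈ A
    · rw [hbal x hxA, hPbal x (hatom x hx)]
      ring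
    · rw [h.bal_eq x (hout x hx hxA), bal_eq_zero_of_inside hPin hxA, add_zero]
  · rw [hcutU]
    by_cases hsub : A' ⊂ A
    · have hch := hnew A' hA' hmax' hsub
      have h1 := hPcut A' hch
      -- the ends of `F` in `A'` are the entry and the base edge of `A`
      have h2 : cut G F A' + ((if r ∈ A' then 1 else 0) + (if r' ∈ A' then 1 else 0)) =
          (if w ∈ A' then 1 else 0) + (if D.𝔅.base A ∈ A' then 1 else 0) := by
        rw [cut_eq_sum_mult h.edge_mem fun s hs hsF hin =>
          h.not_inside A hA s hs hsF ⟨hsub.1 hin.1, hsub.1 hin.2⟩]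
        have h3 : ∑ x ∈ A', (∑ e ∈ F, mult G e x +
            ((if r = x then 1 else 0) + (if r' = x then 1 else 0))) =
            ∑ x ∈ A', ((if w = x then 1 else 0) + (if D.𝔅.base A = x then 1 else 0)) :=
          Finset.sum_congr rfl fun x hx => hdeg x (hsub.1 hx)
        simpa only [Finset.sum_add_distrib, Finset.sum_ite_eq] using h3
      by_cases hb : D.𝔅.base A ∈ A'
      · have h3 := D.base_child hAb hch hb
        have h4 : ¬ D.HasBase P A' := by
          rintro ⟨e, he, hη⟩
          rw [← h3.2] at hη
          exact hPcross A (Or.inl le_rfl) e he (D.baseEdge_crosses hAb hη)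
        have h5 : D.HasBase F A' ↔ D.HasBase F A := by
          simp only [HasBase, h3.2]
        rcases hbase with ⟨h6, h7, h8⟩ | ⟨h6, h7⟩
        · have h9 : r ∉ A' := fun h' => h7 (hsub.1 h')
          have h10 : r' ∉ A' := fun h' => h8 (hsub.1 h')
          simp only [hbaseU, h5, h6, h4, hb, h9, h10, true_or, if_true, if_false] at h1 h2 ⊢
          omega
        · have h8 : ¬ D.HasBase F A := by
            rintro ⟨e, -, he⟩; simp [h6] at he
          have h9 : ((if r ∈ A' then 1 else 0) + (if r' ∈ A' then 1 else 0) : ℤ) = 1 := by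
            rcases h7 with ⟨h7, h7'⟩ | ⟨h7, h7'⟩
            · have : r' ∉ A' := fun h' => h7' (hsub.1 h')
              simp [h7, hb, this]
            · have : r ∉ A' := fun h' => h7' (hsub.1 h')
              simp [h7, hb, this]
          rw [h9] at h2 ⊢
          simp only [hbaseU, h5, h8, h4, hb, or_self, if_true, if_false] at h1 h2 ⊢
          omega
      · obtain ⟨t, ht, hη⟩ := D.baseEdge_child hAb hch hb
        obtain ⟨ht1, ht2, ht3⟩ := hB.steps t ht
        have h5 : ¬ D.HasBase F A' := by
          rintro ⟨e, he, hη'⟩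
          obtain rfl : e = t.edge := by simpa [hη] using hη'.symm
          exact h.not_inside A hA t ht1 he ⟨ht2, ht3⟩
        have h9 : r ∉ A' ∧ r' ∉ A' := by
          constructor
          · intro h'
            apply hb
            rw [(hr A hAb (hsub.1 h')).1]; exact h'
          · intro h'
            apply hb
            rw [(hr' A hAb (hsub.1 h')).1]; exact h'
        simp only [hbaseU, h5, hb, h9.1, h9.2, false_or, if_false] at h1 h2 ⊢
        omega
    · have hAC : A ⊆ A' ∨ Disjoint A A' := by
        rcases D.laminar A hAb A' hA' with h' | h' | h'
        · exact Or.inl h'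
        · by_cases he : A' = A
          · exact Or.inl he.ge
          · exact absurd (h'.ssubset_of_ne he) hsub
        · exact Or.inr h'
      have h1 : ¬ D.HasBase P A' := by
        rintro ⟨e, he, hη⟩
        exact hPcross A' hAC e he (D.baseEdge_crosses hA' hη)
      rw [cut_eq_zero_iff.mpr (hPcross A' hAC), add_zero,
        h.cut_eq A' hA' (hold A' hA' hmax' hsub)]
      simp only [hbaseU, h1, or_false]
  · have hCU := Finset.mem_of_mem_erase hC
    have hCne := (Finset.mem_erase.mp hC).1
    rcases Finset.mem_union.mp hsF with he | he
    · exact h.not_inside C hCU s hs he hin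
    · obtain ⟨t, ht, hts⟩ := hP _ he
      obtain ⟨ht1, ht2, ht3⟩ := hB.steps t ht
      -- the step `t` of the closed trail would be inside a child of `A`
      have htC : t.src ∈ C ∧ t.tgt ∈ C := by
        have hs' : G.IsLink s.edge s.src s.tgt := hs
        have ht' : G.IsLink s.edge t.src t.tgt := hts ▸ ht1
        rcases hs'.eq_and_eq_or_eq_and_eq ht' with h' | h'
        · rw [← h'.1, ← h'.2]; exact hin
        · rw [← h'.1, ← h'.2]; exact hin.symm
      have hCA : C ⊂ A := by
        rcases D.laminar A hAb C (h.blossom C hCU) with h' | h' | h'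
        · exact absurd (h'.ssubset_of_ne (Ne.symm hCne)) (hmax C hCU)
        · exact h'.ssubset_of_ne hCne
        · exact absurd htC.1 (Finset.disjoint_left.mp h' ht2)
      obtain ⟨C', hC', hsub⟩ := D.exists_child_superset (h.blossom C hCU) hCA
      exact hB.not_internal t ht C' hC' ⟨hsub htC.1, hsub htC.2⟩

/-- All contracted blossoms can be expanded. -/
lemma IsPartialTrail.expand_all
    (hr : ∀ A ∈ D.𝔅.blossoms, r ∈ A → D.𝔅.base A = r ∧ D.𝔅.η A = none)
    (hr' : ∀ A ∈ D.𝔅.blossoms, r' ∈ A → D.𝔅.base A = r' ∧ D.𝔅.η A = none)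
    (hclosed : r = r' → 2 ≤ D.deficiency r) (n : ℕ) :
    ∀ (F : Finset E) (U : Finset (Finset V)), U.card = n → D.IsPartialTrail r r' F U →
      ∃ F', D.IsPartialTrail r r' F' ∅ := by
  induction n with
  | zero =>
    intro F U hU h
    exact ⟨F, Finset.card_eq_zero.mp hU ▸ h⟩
  | succ n ih =>
    intro F U hU h
    obtain ⟨A, hA⟩ := U.exists_maximal (Finset.card_pos.mp (by omega))
    obtain ⟨F', hF'⟩ := h.expand hr hr' hclosed hA.prop fun A' hA' hlt =>
      absurd (hA.le_of_ge hA' hlt.le) (not_le_of_gt hlt)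
    exact ih F' _ (by rw [Finset.card_erase_of_mem hA.prop, hU]; rfl) hF'

end StructuredMatching

/-! ### The length of an expanded trail -/

lemma sgn_mul_weight (M : Set E) (e : E) : (sgn M e : ℝ) * weight M e = sgn M e - 1 := by
  unfold sgn weight; split_ifs <;> norm_num

namespace StructuredMatching

variable {f : V → ℕ} {D : StructuredMatching G f} {r r' : V} {F : Finset E}

/-- The signed duals of an edge, in terms of its ends in the blossoms `A`, of whether it leaves `A`
and of whether it is the base edge of `A`. -/
lemma sgn_mul_hyz {s : Step V E} (hs : IsStep G s) :
    2 * (sgn D.edges s.edge : ℝ) * hyz D.edges D.𝔅 D.y D.z s =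
      2 * (sgn D.edges s.edge * (D.y s.src + D.y s.tgt)) +
      ∑ A ∈ D.𝔅.blossoms, D.z A * ((sgn D.edges s.edge * ∑ x ∈ A, mult G s.edge x -
        (if Crosses G s.edge A then 1 else 0) +
        2 * (if D.𝔅.η A = some s.edge then 1 else 0) : ℤ) : ℝ) := by
  rw [hyz, Finset.sum_filter, mul_add, Finset.mul_sum, mul_assoc]
  congr 1
  refine Finset.sum_congr rfl fun A hA => ?_
  have hη : D.𝔅.η A = some s.edge → Crosses G s.edge A := D.baseEdge_crosses hA
  rw [sum_mult_step hs]
  simp only [crosses_step hs, InI, sgn] at hη ⊢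
  by_cases h1 : s.src ∈ A <;> by_cases h2 : s.tgt ∈ A <;> by_cases h3 : s.edge ∈ D.edges <;>
    by_cases h4 : D.𝔅.η A = some s.edge <;> simp [h1, h2, h3, h4, Xor] at hη ⊢ <;> ring

/-- A completely expanded trail has length `1 + 2L`. -/
lemma IsPartialTrail.card_eq (hV : V(G).Finite) (h : D.IsPartialTrail r r' F ∅)
    (hr : r ∈ V(G)) (hr' : r' ∈ V(G)) (hy : D.y r = D.yFree) (hy' : D.y r' = D.yFree) :
    (F.card : ℝ) = 1 + 2 * D.L := by
  have hst : ∀ e, ∃ s : Step V E, e ∈ F → IsStep G s ∧ s.edge = e := by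
    intro e
    by_cases he : e ∈ F
    · obtain ⟨s, hs⟩ := exists_step (h.edge_mem e he)
      exact ⟨s, fun _ => hs⟩
    · exact ⟨⟨r, e, r⟩, fun h => absurd h he⟩
  choose st hst using hst
  have hbal : ∀ x, bal G D.edges F x = (if r = x then 1 else 0) + (if r' = x then 1 else 0) :=
    fun x => h.bal_eq x (by simp)
  -- the signed sum of a vertex function over the ends of the edges of `F`
  have hvert : ∀ g : V → ℝ, ∑ e ∈ F, (sgn D.edges e : ℝ) * (g (st e).src + g (st e).tgt) =
      g r + g r' := by
    intro g
    have h1 : ∀ e ∈ F, (sgn D.edges e : ℝ) * (g (st e).src + g (st e).tgt) =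
        ∑ x ∈ hV.toFinset, g x * ((sgn D.edges e * mult G e x : ℤ) : ℝ) := by
      intro e he
      obtain ⟨h2, h3⟩ := hst e he
      have h4 : G.IsLink (st e).edge (st e).src (st e).tgt := h2
      have h5 : ∀ x, mult G e x = _ := fun x => h3 ▸ mult_step h2 x
      simp only [h5]
      push_cast
      have h6 : ∀ x, g x * ((sgn D.edges e : ℝ) *
          ((if (st e).src = x then (1 : ℝ) else 0) + if (st e).tgt = x then (1 : ℝ) else 0)) =
          (if (st e).src = x then (sgn D.edges e : ℝ) * g x else 0) +
          (if (st e).tgt = x then (sgn D.edges e : ℝ) * g x else 0) := by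
        intro x; split_ifs <;> ring
      simp only [h6, Finset.sum_add_distrib, Finset.sum_ite_eq, Set.Finite.mem_toFinset,
        h4.left_mem, h4.right_mem, if_true]
      ring
    rw [Finset.sum_congr rfl h1, Finset.sum_comm]
    have h2 : ∀ x, ∑ e ∈ F, g x * ((sgn D.edges e * mult G e x : ℤ) : ℝ) =
        (if r = x then g x else 0) + (if r' = x then g x else 0) := by
      intro x
      rw [← Finset.mul_sum, ← Int.cast_sum]
      have h3 : ∑ e ∈ F, sgn D.edges e * mult G e x = _ := hbal x
      rw [h3]
      push_cast
      split_ifs <;> ring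
    simp only [h2, Finset.sum_add_distrib, Finset.sum_ite_eq, Set.Finite.mem_toFinset, hr, hr',
      if_true]
  have hsgn : ∑ e ∈ F, (sgn D.edges e : ℝ) = 1 := by
    have h1 := hvert fun _ => 1
    rw [← Finset.sum_mul] at h1
    linarith
  have hyv := hvert D.y
  -- the contributions of every blossom cancel
  have hblossom : ∀ A ∈ D.𝔅.blossoms, ∑ e ∈ F, (sgn D.edges e * ∑ x ∈ A, mult G e x -
      (if Crosses G e A then 1 else 0) + 2 * (if D.𝔅.η A = some e then 1 else 0) : ℤ) = 0 := by
    intro A hA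
    have h1 := h.cut_eq A hA (by simp)
    rw [Finset.sum_add_distrib, Finset.sum_sub_distrib, ← Finset.mul_sum]
    have h2 : ∑ e ∈ F, sgn D.edges e * ∑ x ∈ A, mult G e x =
        (if r ∈ A then 1 else 0) + (if r' ∈ A then 1 else 0) := by
      simp only [Finset.mul_sum]
      rw [Finset.sum_comm]
      have h3 : ∀ x ∈ A, ∑ e ∈ F, sgn D.edges e * mult G e x = _ := fun x _ => hbal x
      rw [Finset.sum_congr rfl h3, Finset.sum_add_distrib, Finset.sum_ite_eq, Finset.sum_ite_eq]
    have h3 : ∑ e ∈ F, (if D.𝔅.η A = some e then 1 else 0) =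
        (if D.HasBase F A then 1 else 0 : ℤ) := by
      cases hη : D.𝔅.η A with
      | none => simp [HasBase, hη]
      | some e => simp [HasBase, hη]
    rw [h2, h3]
    unfold cut at h1
    omega
  have htotal : ∑ e ∈ F, 2 * ((sgn D.edges e : ℝ) - 1) = 2 * (D.y r + D.y r') := by
    rw [← hyv, Finset.mul_sum]
    have h1 : ∀ e ∈ F, 2 * ((sgn D.edges e : ℝ) - 1) =
        2 * ((sgn D.edges e : ℝ) * (D.y (st e).src + D.y (st e).tgt)) +
        ∑ A ∈ D.𝔅.blossoms, D.z A * ((sgn D.edges e * ∑ x ∈ A, mult G e x -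
        (if Crosses G e A then 1 else 0) + 2 * (if D.𝔅.η A = some e then 1 else 0) : ℤ) : ℝ) := by
      intro e he
      obtain ⟨h2, h3⟩ := hst e he
      have h4 := sgn_mul_hyz (D := D) h2
      have h5 : hyz D.edges D.𝔅 D.y D.z (st e) = weight D.edges (st e).edge :=
        h.tight _ h2 (by rwa [h3])
      rw [h5, mul_assoc, sgn_mul_weight, h3] at h4
      exact h4
    rw [Finset.sum_congr rfl h1, Finset.sum_add_distrib, Finset.sum_comm]
    have h2 : ∀ A ∈ D.𝔅.blossoms, ∑ e ∈ F, D.z A * ((sgn D.edges e * ∑ x ∈ A, mult G e x -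
        (if Crosses G e A then 1 else 0) + 2 * (if D.𝔅.η A = some e then 1 else 0) : ℤ) : ℝ) =
        0 := by
      intro A hA
      rw [← Finset.mul_sum, ← Int.cast_sum, hblossom A hA]
      simp
    rw [Finset.sum_eq_zero h2, add_zero]
  rw [← Finset.mul_sum, Finset.sum_sub_distrib, hsgn] at htotal
  simp only [Finset.sum_const, nsmul_eq_mul, mul_one] at htotal
  rw [hy, hy'] at htotal
  unfold L
  linarith

/-- A completely expanded trail contains an augmenting trail, of length at most `1 + 2L`. -/
lemma IsPartialTrail.exists_isAugmenting (hV : V(G).Finite) (h : D.IsPartialTrail r r' F ∅)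
    (hr : D.Free r) (hr' : D.Free r') (hclosed : r = r' → 2 ≤ D.deficiency r) :
    ∃ T : OTrail V E, D.IsAugmenting T ∧ (T.steps.length : ℝ) ≤ 1 + 2 * D.L := by
  obtain ⟨p, h1, h2, h3, h4, h5, h6, h7⟩ := exists_alternating_trail (G := G) (M := D.edges) r'
    F.card F r 1 rfl h.edge_mem (Or.inl rfl) (fun x => by rw [h.bal_eq x (by simp), one_mul])
  refine ⟨⟨r, p, r'⟩, ⟨fun h' => by simpa using h7 h', h1, h2, h4, fun s hs hsM => ?_, h6, hr, hr',
    hclosed⟩, ?_⟩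
  · have := h5 s hs
    simp [sgn, hsM] at this
  · rw [← h.card_eq hV hr.1 hr'.1 (D.y_free r hr) (D.y_free r' hr')]
    have h8 : (p.map Step.edge).toFinset ⊆ F := by
      intro e he
      simp only [List.mem_toFinset, List.mem_map] at he
      obtain ⟨s, hs, rfl⟩ := he
      exact h3 s hs
    have h9 := Finset.card_le_card h8
    rw [List.toFinset_card_of_nodup h2, List.length_map] at h9
    exact_mod_cast h9

end StructuredMatching

/-! ### The trail found by the search -/

namespace StructuredMatching

variable {f : V → ℕ} (D : StructuredMatching G f)

lemma mem_node (v : V) : v ∈ D.𝔅.node v := Finset.mem_insert_self _ _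

lemma node_of_mem_blossom {v : V} {A : Finset V} (hA : A ∈ D.𝔅.blossoms) (hv : v ∈ A) :
    D.𝔅.node v ∈ D.𝔅.blossoms ∧ A ⊆ D.𝔅.node v := by
  have hsub : ∀ B ∈ D.𝔅.blossoms, v ∈ B → B ⊆ D.𝔅.node v := by
    intro B hB hvB
    have h1 : B ≤ (D.𝔅.blossoms.filter fun B => v ∈ B).sup id :=
      Finset.le_sup (f := id) (Finset.mem_filter.mpr ⟨hB, hvB⟩)
    exact h1.trans (Finset.subset_insert _ _)
  refine ⟨?_, hsub A hA hv⟩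
  obtain ⟨C, hC⟩ := (D.𝔅.blossoms.filter fun B => v ∈ B).exists_maximal
    ⟨A, Finset.mem_filter.mpr ⟨hA, hv⟩⟩
  have hC1 := Finset.mem_filter.mp hC.prop
  have h1 : D.𝔅.node v = C := by
    refine (Finset.Subset.antisymm ?_ (hsub C hC1.1 hC1.2))
    refine Finset.insert_subset hC1.2 (Finset.sup_le fun B hB => ?_)
    have hB1 := Finset.mem_filter.mp hB
    rcases D.laminar B hB1.1 C hC1.1 with h | h | h
    · exact h
    · exact hC.le_of_ge hB h
    · exact absurd hC1.2 (Finset.disjoint_left.mp h hB1.2)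
  rw [h1]; exact hC1.1

lemma node_of_notMem_blossoms {v : V} (h : D.𝔅.node v ∉ D.𝔅.blossoms) : D.𝔅.node v = {v} := by
  have h1 : (D.𝔅.blossoms.filter fun B => v ∈ B) = ∅ := by
    rw [Finset.filter_eq_empty_iff]
    intro A hA hv
    exact h (D.node_of_mem_blossom hA hv).1
  rw [BlossomData.node, h1]
  rfl

lemma node_eq_of_mem {u v : V} (h : u ∈ D.𝔅.node v) : D.𝔅.node u = D.𝔅.node v := by
  by_cases hb : D.𝔅.node v ∈ D.𝔅.blossoms
  · have h1 := D.node_of_mem_blossom hb h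
    exact Finset.Subset.antisymm (D.node_of_mem_blossom h1.1 (h1.2 (D.mem_node v))).2 h1.2
  · rw [D.node_of_notMem_blossoms hb, Finset.mem_singleton] at h
    rw [h]

/-- A blossom inside `B` containing the base vertex of `B` has this base vertex. -/
lemma base_eq_of_subset (v : V) (B : Finset V) : B ∈ D.𝔅.blossoms → D.𝔅.base B = v →
    ∀ A ∈ D.𝔅.blossoms, A ⊆ B → v ∈ A → D.𝔅.base A = v := by
  induction B using Finset.strongInduction with
  | H B ih =>
    intro hB hb A hA hAB hv
    by_cases hne : A = B
    · rw [hne, hb]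
    · obtain ⟨C, hC, hAC⟩ := D.exists_child_superset hA (hAB.ssubset_of_ne hne)
      have h1 := D.base_child hB hC (by rw [hb]; exact hAC hv)
      exact ih C hC.2.1 hC.1 (h1.1.symm.trans hb) A hA hAC hv

lemma Tight.congr {D : StructuredMatching G f} {s t : Step V E} (hs : IsStep G s)
    (ht : IsStep G t) (he : s.edge = t.edge) (h : D.Tight s) : D.Tight t := by
  have hs' : G.IsLink s.edge s.src s.tgt := hs
  have ht' : G.IsLink s.edge t.src t.tgt := he ▸ ht
  obtain ⟨u, e, v⟩ := s
  obtain ⟨u', e', v'⟩ := t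
  simp only at he hs' ht'
  subst he
  rcases hs'.eq_and_eq_or_eq_and_eq ht' with ⟨rfl, rfl⟩ | ⟨rfl, rfl⟩
  · exact h
  · have heq : hyz D.edges D.𝔅 D.y D.z ⟨v, e, u⟩ = hyz D.edges D.𝔅 D.y D.z ⟨u, e, v⟩ := by
      unfold hyz
      rw [Finset.sum_filter, Finset.sum_filter]
      simp only
      rw [add_comm (D.y v)]
      congr 1
      refine Finset.sum_congr rfl fun A _ => if_congr ?_ rfl rfl
      simp only [InI, xor_comm (v ∈ A), and_comm (a := v ∈ A)]
    unfold Tight at *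
    rw [heq, h]

end StructuredMatching

namespace SearchStructure

variable {f : V → ℕ} {D : StructuredMatching G f} (S : SearchStructure D)

/-- The search makes every free vertex the base vertex of all blossoms containing it. -/
lemma base_eq_of_free (S : SearchStructure D) {v : V} (hv : D.Free v) {A : Finset V}
    (hA : A ∈ D.𝔅.blossoms) (hvA : v ∈ A) : D.𝔅.base A = v ∧ D.𝔅.η A = none := by
  obtain ⟨-, -, h3⟩ := S.free_root v hv
  obtain ⟨h4, h5⟩ := D.node_of_mem_blossom hA hvA
  have h6 : D.𝔅.base (D.𝔅.node v) = v := by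
    rcases h3 with h | h
    · exact h.2
    · exact absurd h4 h.1
  have h7 := D.base_eq_of_subset v _ h4 h6 A hA h5 hvA
  exact ⟨h7, ((D.isBlossom A hA).artificial_iff).mpr (h7.symm ▸ hv)⟩

lemma node_eq {X : Finset V} (hX : X ∈ S.nodes) {x : V} (hx : x ∈ X) : D.𝔅.node x = X := by
  obtain ⟨v, -, rfl⟩ := S.nodes_spec X hX
  exact D.node_eq_of_mem hx

lemma eq_singleton {X : Finset V} (hX : X ∈ S.nodes) (hb : X ∉ D.𝔅.blossoms) {x : V}
    (hx : x ∈ X) : X = {x} := by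
  have h := S.node_eq hX hx
  rw [← h] at hb ⊢
  exact D.node_of_notMem_blossoms hb

lemma path_cases {X R : Finset V} {p : List (Step V E)} (h : ParentPath D.𝔅.node S.τ X p R) :
    (S.τ X = none ∧ R = X) ∨ ∃ t p', S.τ X = some t ∧ p = t :: p' := by
  cases h with
  | root _ h => exact Or.inl ⟨h, rfl⟩
  | cons _ s p _ h _ => exact Or.inr ⟨s, p, h, rfl⟩

lemma path_spec {X R : Finset V} {p : List (Step V E)} (h : ParentPath D.𝔅.node S.τ X p R)
    (hX : X ∈ S.nodes) :
    R ∈ S.nodes ∧ S.τ R = none ∧ ∀ t ∈ p, ∃ Y ∈ S.nodes, S.τ Y = some t := by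
  induction h with
  | root X h => exact ⟨hX, h, by simp⟩
  | cons X s p R h _ ih =>
    obtain ⟨h1, h2, h3⟩ := ih (S.parent X hX s h).2.2.1
    refine ⟨h1, h2, fun t ht => ?_⟩
    rcases List.mem_cons.mp ht with rfl | ht
    · exact ⟨X, hX, h⟩
    · exact h3 t ht

/-- The sign of the child edges of the atom `X`. -/
noncomputable def childSgn (X : Finset V) : ℤ := if ∃ t ∈ S.τ X, t.edge ∉ D.edges then -1 else 1

lemma sgn_eq_childSgn {X : Finset V} {e : E}
    (h : e ∈ D.edges ↔ ∃ t ∈ S.τ X, t.edge ∉ D.edges) : sgn D.edges e = S.childSgn X := by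
  unfold sgn childSgn
  exact if_congr h rfl rfl

lemma childSgn_eq_neg {X : Finset V} {t : Step V E} (h : S.τ X = some t) :
    S.childSgn X = -sgn D.edges t.edge := by
  unfold sgn childSgn
  by_cases h1 : t.edge ∈ D.edges <;> simp [h, h1]

/-- At an atom `x` off the blossoms of the search, an edge alternating with the parent edge of its
end node `X` contributes the sign of the child edges of `X`, if `X = {x}`. -/
lemma sgn_mul_eq {X : Finset V} (hX : X ∈ S.nodes) {x u : V} {e : E} (hu : u ∈ X)
    (hx : ∀ Y ∈ S.nodes, Y ∈ D.𝔅.blossoms → x ∉ Y)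
    (h : X ∉ D.𝔅.blossoms → (e ∈ D.edges ↔ ∃ t ∈ S.τ X, t.edge ∉ D.edges)) :
    sgn D.edges e * (if u = x then 1 else 0) = S.childSgn X * (if x ∈ X then 1 else 0) := by
  by_cases hxX : x ∈ X
  · have hb : X ∉ D.𝔅.blossoms := fun hb => hx X hX hb hxX
    have h1 := S.eq_singleton hX hb hxX
    rw [h1, Finset.mem_singleton] at hu
    rw [S.sgn_eq_childSgn (h hb)]
    simp [hu, hxX]
  · have : u ≠ x := by rintro rfl; exact hxX hu
    simp [this, hxX]

/-- A path to the root is balanced at the atoms, except at its ends. -/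
lemma path_bal {x : V} (hx : ∀ Y ∈ S.nodes, Y ∈ D.𝔅.blossoms → x ∉ Y) {X R : Finset V}
    {p : List (Step V E)} (h : ParentPath D.𝔅.node S.τ X p R) (hX : X ∈ S.nodes) :
    listBal D.edges p x + S.childSgn X * (if x ∈ X then 1 else 0) = if x ∈ R then 1 else 0 := by
  induction h with
  | root X h =>
    have : S.childSgn X = 1 := by simp [childSgn, h]
    simp [this]
  | cons X s p R h _ ih =>
    obtain ⟨h1, h2, h3, -⟩ := S.parent X hX s h
    have ih := ih h3
    have h4 := S.sgn_mul_eq h3 (D.mem_node s.tgt) hx (S.alternating X hX s h)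
    have h5 : sgn D.edges s.edge * (if s.src = x then 1 else 0) =
        -(S.childSgn X * (if x ∈ X then 1 else 0)) := by
      rw [S.childSgn_eq_neg h]
      by_cases hxX : x ∈ X
      · have h6 := S.eq_singleton hX (fun hb => hx X hX hb hxX) hxX
        rw [h6, Finset.mem_singleton] at h2
        simp [h2, hxX]
      · have : s.src ≠ x := by rintro rfl; exact hxX h2
        simp [this, hxX]
    rw [listBal_cons, mul_add, h4, h5]
    linarith

lemma mem_iff_eq {X A : Finset V} (hX : X ∈ S.nodes) (hA : A ∈ S.nodes) {u : V} (hu : u ∈ X) :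
    u ∈ A ↔ X = A := by
  constructor
  · intro h; rw [← S.node_eq hX hu, ← S.node_eq hA h]
  · rintro rfl; exact hu

lemma path_count {A : Finset V} (hA : A ∈ S.nodes) {X R : Finset V}
    {p : List (Step V E)} (h : ParentPath D.𝔅.node S.τ X p R) (hX : X ∈ S.nodes) :
    tgtCount A p + (if X = A then 1 else 0) = srcCount A p + (if R = A then 1 else 0) := by
  induction h with
  | root X h => simp
  | cons X s p R h _ ih =>
    obtain ⟨h1, h2, h3, -⟩ := S.parent X hX s h
    have ih := ih h3
    rw [tgtCount_cons, srcCount_cons]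
    simp only [S.mem_iff_eq hX hA h2, S.mem_iff_eq h3 hA (D.mem_node s.tgt)]
    linarith

/-- The edges found by the search, in the graph with all blossoms contracted, form a trail between
two free vertices. -/
lemma exists_isPartialTrail (hS : S.FindsAugmentingTrail) :
    ∃ r r' F U, D.Free r ∧ D.Free r' ∧ (r = r' → 2 ≤ D.deficiency r) ∧
      D.IsPartialTrail r r' F U := by
  obtain ⟨s, p, q, R, R', r, r', hs, hst, hsX, hsY, haX, haY, hp, hq, hnd, hR, hR', hclosed⟩ := hS
  obtain ⟨hRn, hRτ, hpn⟩ := S.path_spec hp hsX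
  obtain ⟨hRn', hRτ', hqn⟩ := S.path_spec hq hsY
  have hroot : ∀ R ∈ S.nodes, S.τ R = none → ∀ r, D.𝔅.IsNodeBase R r → D.Free r ∧ r ∈ R := by
    intro R hRn hRτ r hR
    obtain ⟨v, hv, hvf⟩ := S.root_free R hRn hRτ
    rcases hR with ⟨h1, h2⟩ | ⟨h1, h2⟩
    · rcases hv with ⟨h3, h4⟩ | ⟨h3, h4⟩
      · rw [← h2]; exact ⟨h4 ▸ hvf, D.base_mem R h1⟩
      · exact absurd h1 h3
    · rcases hv with ⟨h3, h4⟩ | ⟨h3, h4⟩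
      · exact absurd h3 h1
      · obtain rfl : v = r := by simpa [h2] using h4.symm
        exact ⟨hvf, by simp [h2]⟩
  obtain ⟨hr, hrR⟩ := hroot R hRn hRτ r hR
  obtain ⟨hr', hrR'⟩ := hroot R' hRn' hRτ' r' hR'
  set l := p ++ s :: q with hl
  have hmem : ∀ t, t ∈ l ↔ (t ∈ p ∨ t ∈ q) ∨ t = s := by
    intro t; simp only [hl, List.mem_append, List.mem_cons]; tauto
  have hpath : ∀ t, t ∈ p ∨ t ∈ q → ∃ Y ∈ S.nodes, S.τ Y = some t := by
    rintro t (ht | ht)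
    exacts [hpn t ht, hqn t ht]
  -- all steps of the trail are tight steps between nodes of the search
  have hstep : ∀ t ∈ l, IsStep G t ∧ D.Tight t ∧ D.𝔅.node t.src ∈ S.nodes ∧
      D.𝔅.node t.tgt ∈ S.nodes := by
    intro t ht
    rcases (hmem t).mp ht with ht | rfl
    · obtain ⟨Y, hY, hτ⟩ := hpath t ht
      obtain ⟨h1, h2, h3, h4⟩ := S.parent Y hY t hτ
      exact ⟨h1, h4, by rwa [S.node_eq hY h2], h3⟩
    · exact ⟨hs, hst, hsX, hsY⟩
  -- a path step starting in a node of the search is the parent step of the node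
  have hsrc : ∀ A ∈ S.nodes, ∀ t, t ∈ p ∨ t ∈ q → t.src ∈ A → S.τ A = some t := by
    intro A hA t ht htA
    obtain ⟨Y, hY, hτ⟩ := hpath t ht
    rwa [← (S.mem_iff_eq hY hA (S.parent Y hY t hτ).2.1).mp htA]
  have hinside : ∀ A ∈ S.nodes, A ∈ D.𝔅.blossoms → ∀ t ∈ l, ¬ (t.src ∈ A ∧ t.tgt ∈ A) := by
    rintro A hA hAb t ht ⟨h1, h2⟩
    rcases (hmem t).mp ht with ht' | rfl
    · have h3 := S.parent_blossom A hA hAb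
      rw [hsrc A hA t ht' h1] at h3
      rcases (crosses_step (hstep t ht).1 A).mp (D.baseEdge_crosses hAb h3) with h | h
      · exact h.2 h2
      · exact h.2 h1
    · rw [S.node_eq hA h1] at hp
      rw [S.node_eq hA h2] at hq
      rcases S.path_cases hp with ⟨h3, h4⟩ | ⟨t', p', h3, h4⟩
      · -- both paths are trivial, at a free blossom
        rcases S.path_cases hq with ⟨-, h5⟩ | ⟨t', p', h5, -⟩
        · have h6 := S.base_eq_of_free hr hAb (h4 ▸ hrR)
          have h7 := S.base_eq_of_free hr' hAb (h5 ▸ hrR')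
          have h8 := (D.isBlossom A hAb).free_light (((D.isBlossom A hAb).artificial_iff).mp h6.2)
          have h9 := hclosed (h6.1.symm.trans h7.1)
          rw [h6.1] at h8
          omega
        · simp [h3] at h5
      · rcases S.path_cases hq with ⟨h5, -⟩ | ⟨t'', q', h5, h6⟩
        · simp [h3] at h5
        · obtain rfl : t' = t'' := by simpa [h3] using h5
          rw [hl, h4, h6] at hnd
          simp at hnd
  have hlst : ∀ t ∈ l, IsStep G t := fun t ht => (hstep t ht).1
  have hF : ∀ e, e ∈ (l.map Step.edge).toFinset ↔ ∃ t ∈ l, t.edge = e := by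
    intro e; rw [List.mem_toFinset, List.mem_map]
  refine ⟨r, r', (l.map Step.edge).toFinset,
    D.𝔅.blossoms.filter fun A => ∃ X ∈ S.nodes, X ∈ D.𝔅.blossoms ∧ A ⊆ X, hr, hr', hclosed,
    ⟨fun A hA => (Finset.mem_filter.mp hA).1, ?_, ?_, ?_, ?_, ?_, ?_, ?_⟩⟩
  · intro A hA A' hA' hsub
    obtain ⟨-, X, hX, hXb, hAX⟩ := Finset.mem_filter.mp hA
    exact Finset.mem_filter.mpr ⟨hA', X, hX, hXb, hsub.1.trans hAX⟩
  · intro e he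
    obtain ⟨t, ht, rfl⟩ := (hF e).mp he
    exact (hlst t ht).mem_edgeSet
  · intro s' hs' he
    obtain ⟨t, ht, hte⟩ := (hF _).mp he
    exact (hstep t ht).2.1.congr (hlst t ht) hs' hte
  · rintro A hA s' hs' ht
    obtain ⟨hAb, X, hX, hXb, hAX⟩ := Finset.mem_filter.mp hA
    exact S.tight_blossom X hX hXb s' hs' ⟨A, hAb, hAX, ht⟩
  · intro x hxU
    have hx : ∀ Y ∈ S.nodes, Y ∈ D.𝔅.blossoms → x ∉ Y := fun Y hY hYb =>
      hxU Y (Finset.mem_filter.mpr ⟨hYb, Y, hY, hYb, subset_rfl⟩)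
    have hend : ∀ R ∈ S.nodes, ∀ r ∈ R,
        ((if r = x then 1 else 0) : ℤ) = if x ∈ R then 1 else 0 := by
      intro R hRn r hrR
      by_cases hxR : x ∈ R
      · rw [S.eq_singleton hRn (fun hb => hx R hRn hb hxR) hxR, Finset.mem_singleton] at hrR
        simp [hrR, hxR]
      · have : r ≠ x := by rintro rfl; exact hxR hrR
        simp [hxR, this]
    rw [bal_toFinset hnd hlst, hl, listBal_append, listBal_cons, mul_add, hend R hRn r hrR,
      hend R' hRn' r' hrR', ← S.path_bal hx hp hsX, ← S.path_bal hx hq hsY,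
      S.sgn_mul_eq hsX (D.mem_node s.src) hx haX, S.sgn_mul_eq hsY (D.mem_node s.tgt) hx haY]
    ring
  · intro A hAb hmax
    by_cases hA : A ∈ S.nodes
    · have hcut := cut_toFinset hnd hlst (hinside A hA hAb)
      have h1 := S.path_count hA hp hsX
      have h2 := S.path_count hA hq hsY
      have h3 := S.parent_blossom A hA hAb
      have n1 := srcCount_nonneg A p
      have n2 := srcCount_nonneg A q
      rw [hl, srcCount_append, tgtCount_append, srcCount_cons, tgtCount_cons, ← hl] at hcut
      simp only [S.mem_iff_eq hsX hA (D.mem_node s.src),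
        S.mem_iff_eq hsY hA (D.mem_node s.tgt)] at hcut
      simp only [S.mem_iff_eq hRn hA hrR, S.mem_iff_eq hRn' hA hrR']
      -- both sides are twice the number of parent steps of `A`, plus the number of ends
      suffices hbase : srcCount A p + srcCount A q =
          if D.HasBase (l.map Step.edge).toFinset A then 1 else 0 by
        omega
      cases hτ : S.τ A with
      | none =>
        rw [hτ] at h3
        have h4 : ¬ D.HasBase (l.map Step.edge).toFinset A := by
          rintro ⟨e, -, he⟩; simp [h3] at he
        have h5 : ∀ p', (∀ t ∈ p', t ∈ p ∨ t ∈ q) → srcCount A p' = 0 := by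
          intro p' hp'
          rw [srcCount_eq_countP]
          refine Int.natCast_eq_zero.mpr (List.countP_eq_zero.mpr fun t ht htA => ?_)
          have := hsrc A hA t (hp' t ht) (by simpa using htA)
          simp [hτ] at this
        rw [h5 p fun t => Or.inl, h5 q fun t => Or.inr]
        simp [h4]
      | some t₀ =>
        rw [hτ] at h3
        have h4 : srcCount A p + srcCount A q ≤ 1 := by
          rw [← srcCount_append, srcCount_eq_countP]
          have h5 : (p ++ q).countP (fun t => t.src ∈ A) ≤
              ((p ++ q).map Step.edge).count t₀.edge := by
            rw [List.count, List.countP_map]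
            refine List.countP_mono_left fun t ht htA => ?_
            have := hsrc A hA t (List.mem_append.mp ht) (by simpa using htA)
            rw [hτ] at this
            simp [Option.some.inj this]
          have h6 : ((p ++ q).map Step.edge).Nodup :=
            hnd.sublist (((List.sublist_cons_self s q).append_left p).map _)
          exact_mod_cast h5.trans (List.nodup_iff_count_le_one.mp h6 _)
        have h5 : 1 ≤ srcCount A p + srcCount A q ↔
            D.HasBase (l.map Step.edge).toFinset A := by
          constructor
          · intro h
            rw [← srcCount_append, srcCount_eq_countP] at h
            obtain ⟨t, ht, htA⟩ := List.countP_pos_iff.mp (by exact_mod_cast h)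
            have h6 := hsrc A hA t (List.mem_append.mp ht) (by simpa using htA)
            rw [hτ] at h6
            obtain rfl := Option.some.inj h6
            exact ⟨t₀.edge,
              (hF _).mpr ⟨t₀, (hmem _).mpr (Or.inl (List.mem_append.mp ht)), rfl⟩, h3⟩
          · rintro ⟨e, he, hη⟩
            have h6 : cut G (l.map Step.edge).toFinset A ≠ 0 := fun h =>
              StructuredMatching.cut_eq_zero_iff.mp h e he (D.baseEdge_crosses hAb hη)
            have h7 : R ≠ A := by rintro rfl; simp [hτ] at hRτ
            have h8 : R' ≠ A := by rintro rfl; simp [hτ] at hRτ'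
            simp only [h7, h8, if_false] at h1 h2
            omega
        split_ifs with h6
        · have := h5.mpr h6; omega
        · have : ¬ 1 ≤ srcCount A p + srcCount A q := fun h => h6 (h5.mp h)
          omega
    · -- the trail avoids a blossom that is not part of the search
      have hno : ∀ x ∈ A, D.𝔅.node x ∉ S.nodes := by
        intro x hx hn
        obtain ⟨h1, h2⟩ := D.node_of_mem_blossom hAb hx
        refine hmax _ (Finset.mem_filter.mpr ⟨h1, _, hn, h1, subset_rfl⟩)
          (h2.ssubset_of_ne ?_)
        rintro he
        exact hA (he ▸ hn)
      have h1 : ∀ e ∈ (l.map Step.edge).toFinset, ¬ Crosses G e A := by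
        intro e he hcr
        obtain ⟨t, ht, rfl⟩ := (hF e).mp he
        obtain ⟨h1, -, h2, h3⟩ := hstep t ht
        rcases (crosses_step h1 A).mp hcr with h | h
        · exact hno _ h.1 h2
        · exact hno _ h.1 h3
      have h2 : ¬ D.HasBase (l.map Step.edge).toFinset A := by
        rintro ⟨e, he, hη⟩
        exact h1 e he (D.baseEdge_crosses hAb hη)
      have h3 : r ∉ A := fun h => hno r h (by rwa [S.node_eq hRn hrR])
      have h4 : r' ∉ A := fun h => hno r' h (by rwa [S.node_eq hRn' hrR'])
      rw [StructuredMatching.cut_eq_zero_iff.mpr h1]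
      simp [h2, h3, h4]
  · rintro A hA s' hs' he ⟨h1, h2⟩
    obtain ⟨hAb, X, hX, hXb, hAX⟩ := Finset.mem_filter.mp hA
    obtain ⟨t, ht, hte⟩ := (hF _).mp he
    have hs'' : G.IsLink s'.edge s'.src s'.tgt := hs'
    have ht' : G.IsLink s'.edge t.src t.tgt := hte ▸ hlst t ht
    refine hinside X hX hXb t ht ?_
    rcases hs''.eq_and_eq_or_eq_and_eq ht' with h | h
    · rw [← h.1, ← h.2]; exact ⟨hAX h1, hAX h2⟩
    · rw [← h.1, ← h.2]; exact ⟨hAX h2, hAX h1⟩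

/-- There is an augmenting trail of length at most `1 + 2L`. -/
lemma exists_isAugmenting (hS : S.FindsAugmentingTrail) (hV : V(G).Finite) :
    ∃ T : OTrail V E, D.IsAugmenting T ∧ (T.steps.length : ℝ) ≤ 1 + 2 * D.L := by
  obtain ⟨r, r', F, U, hr, hr', hclosed, h⟩ := S.exists_isPartialTrail hS
  obtain ⟨F', hF'⟩ := StructuredMatching.IsPartialTrail.expand_all
    (fun A hA hrA => S.base_eq_of_free hr hA hrA) (fun A hA hrA => S.base_eq_of_free hr' hA hrA)
    hclosed _ F U rfl h
  exact hF'.exists_isAugmenting hV hr hr' hclosed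

end SearchStructure

/-! ### Levels along lists of steps -/

lemma IsWalk.spec {p : List (Step V E)} : ∀ {u v : V}, IsWalk G u p v →
    p.IsChain (fun s t => s.tgt = t.src) ∧ (∀ s ∈ p, IsStep G s) ∧
    (∀ s ∈ p.head?, s.src = u) ∧ (∀ s ∈ p.getLast?, s.tgt = v) := by
  induction p with
  | nil => intro u v _; simp
  | cons s p ih =>
    rintro u v ⟨h1, h2, h3⟩
    obtain ⟨i1, i2, i3, i4⟩ := ih h3
    refine ⟨?_, by simpa using ⟨h2, i2⟩, by simpa using h1, ?_⟩
    · cases p with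
      | nil => simp
      | cons t p => exact List.isChain_cons_cons.mpr ⟨(i3 t (by simp)).symm, i1⟩
    · cases p with
      | nil => simpa [IsWalk] using h3
      | cons t p => rwa [List.getLast?_cons_cons]

/-- If every step gains at most one level, the total gain is at most the length. -/
lemma level_le_add_length (a b : Step V E → ℝ) (p : List (Step V E)) : ∀ s : Step V E,
    (s :: p).IsChain (fun s t => b s = a t) → (∀ t ∈ s :: p, b t ≤ a t + 1) →
    ∀ t ∈ (s :: p).getLast?, b t ≤ a s + (s :: p).length := by
  induction p with
  | nil =>
    intro s _ h t ht
    simp only [List.getLast?_singleton, Option.mem_def, Option.some.injEq] at ht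
    subst ht
    simpa using h s
  | cons s' p ih =>
    intro s hc h t ht
    rw [List.isChain_cons_cons] at hc
    rw [List.getLast?_cons_cons] at ht
    have h1 := ih s' hc.2 (fun t ht => h t (List.mem_cons_of_mem _ ht)) t ht
    have h2 := h s (by simp)
    rw [hc.1] at h2
    rw [List.length_cons, Nat.cast_add, Nat.cast_one]
    linarith

/-- If the levels are integers and every step gains at most one level, every layer is traversed. -/
lemma exists_step_in_layer (a b : Step V E → ℝ) (k : ℕ) (p : List (Step V E)) : ∀ s : Step V E,
    (s :: p).IsChain (fun s t => b s = a t) → (∀ t ∈ s :: p, b t ≤ a t + 1) →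
    (∀ t ∈ s :: p, (∃ m : ℤ, a t = m) ∧ ∃ m : ℤ, b t = m) → a s ≤ k →
    (∀ t ∈ (s :: p).getLast?, (k : ℝ) < b t) →
    ∃ (n : ℕ) (hn : n < (s :: p).length), a (s :: p)[n] = k ∧ b (s :: p)[n] = k + 1 := by
  induction p with
  | nil =>
    intro s _ h hint hs hlast
    have h1 : (k : ℝ) < b s := hlast s (by simp)
    have h2 := h s (by simp)
    obtain ⟨⟨m, hm⟩, ⟨m', hm'⟩⟩ := hint s (by simp)
    refine ⟨0, by simp, ?_⟩
    simp only [List.getElem_cons_zero]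
    rw [hm] at h2 hs ⊢
    rw [hm'] at h2 h1 ⊢
    norm_cast at *
    omega
  | cons s' p ih =>
    intro s hc h hint hs hlast
    rw [List.isChain_cons_cons] at hc
    by_cases h1 : (k : ℝ) < b s
    · have h2 := h s (by simp)
      obtain ⟨⟨m, hm⟩, ⟨m', hm'⟩⟩ := hint s (by simp)
      refine ⟨0, by simp, ?_⟩
      simp only [List.getElem_cons_zero]
      rw [hm] at h2 hs ⊢
      rw [hm'] at h2 h1 ⊢
      norm_cast at *
      omega
    · obtain ⟨n, hn, h2⟩ := ih s' hc.2 (fun t ht => h t (List.mem_cons_of_mem _ ht))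
        (fun t ht => hint t (List.mem_cons_of_mem _ ht)) (by rw [← hc.1]; exact not_lt.mp h1)
        (fun t ht => hlast t (by rwa [List.getLast?_cons_cons]))
      exact ⟨n + 1, by simpa using hn, by simpa using h2⟩

namespace StructuredMatching

variable {f : V → ℕ} (D : StructuredMatching G f)

/-! ### Petalevels along augmenting trails -/

/-- The shortened rule gives a blossom the same in-value whenever it is entered, so all entrance
sequences agree with the in-values of `LG*`. -/
lemma entrance_eq (𝒯 : Finset (OTrail V E)) (T : OTrail V E) (n : ℕ) :
    D.entrance 𝒯 T n = D.entryValue 𝒯 := by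
  have h : ∀ l : List (Step V E), l.foldl (D.advance 𝒯) (D.entryValue 𝒯) = D.entryValue 𝒯 := by
    intro l
    induction l with
    | nil => rfl
    | cons s l ih =>
      have : D.advance 𝒯 (D.entryValue 𝒯) s = D.entryValue 𝒯 := by
        funext A; simp [advance]
      rw [List.foldl_cons, this, ih]
  exact h _

lemma entryValue_eq_b {𝒯 : Finset (OTrail V E)} {A : Finset V} :
    D.entryValue 𝒯 A = .b ↔ D.EntersOnBase 𝒯 A := by
  unfold entryValue; split_ifs with h <;> simp [h]

lemma entryValue_eq_p {𝒯 : Finset (OTrail V E)} {A : Finset V} :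
    D.entryValue 𝒯 A = .p ↔ ¬ D.EntersOnBase 𝒯 A := by
  unfold entryValue; split_ifs with h <;> simp [h]

variable {D} {𝒯 : Finset (OTrail V E)} {T : OTrail V E}

/-- A blossom left on its base edge is not entered on it: the edge is used only once. -/
lemma not_entersOnBase_of_leaves (h : D.IsTrailCollection 𝒯) (hT : T ∈ 𝒯) {s : Step V E}
    (hs : s ∈ T.steps) {A : Finset V} (hη : D.𝔅.η A = some s.edge) (hsA : s.src ∈ A) :
    ¬ D.EntersOnBase 𝒯 A := by
  unfold EntersOnBase
  rw [hη]
  rintro ⟨T', hT', s', hs', he, hsrc, -⟩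
  by_cases hTT : T = T'
  · subst hTT
    exact hsrc (List.inj_on_of_nodup_map (h.augmenting T hT).nodup hs' hs he ▸ hsA)
  · exact h.disjoint T hT T' hT' hTT (List.mem_map_of_mem hs) (he ▸ List.mem_map_of_mem hs')

lemma entersOnBase_of_enters (hT : T ∈ 𝒯) {s : Step V E}
    (hs : s ∈ T.steps) {A : Finset V} (hη : D.𝔅.η A = some s.edge) (hsA : s.src ∉ A)
    (htA : s.tgt ∈ A) : D.EntersOnBase 𝒯 A := by
  unfold EntersOnBase
  rw [hη]
  exact ⟨T, hT, s, hs, rfl, hsA, htA⟩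

/-- A trail gains at most one level at each step. For an unmatched edge, the blossoms counted in
the dual `yz` are counted in the petalevels, and for a matched edge conversely. -/
lemma lgLevel_step_le (h : D.IsTrailCollection 𝒯) (hT : T ∈ 𝒯) {s : Step V E}
    (hs : s ∈ T.steps) (hstep : IsStep G s) :
    D.lgLevel 𝒯 (s.tgt, ioType D.edges s.edge) ≤
      D.lgLevel 𝒯 (s.src, (ioType D.edges s.edge).opp) + 1 := by
  have hleave := fun A => not_entersOnBase_of_leaves (D := D) (A := A) h hT hs
  have henter := fun A => entersOnBase_of_enters (D := D) (A := A) hT hs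
  by_cases hM : s.edge ∈ D.edges
  · have h1 := D.underrated s hstep hM
    have h2 : D.zIn .p s.tgt (D.entryValue 𝒯) + D.zIn .b s.src (D.entryValue 𝒯) ≤
        ∑ A ∈ D.𝔅.blossoms with (s.src ∈ A ∧ s.tgt ∈ A) ∨ InI D.edges D.𝔅 A s, D.z A := by
      simp only [zIn, entryValue_eq_b, entryValue_eq_p, Finset.sum_filter]
      rw [← Finset.sum_add_distrib]
      refine Finset.sum_le_sum fun A _ => ?_
      have hz := D.z_nonneg A
      have e1 := hleave A
      have e2 := henter A
      by_cases a1 : s.src ∈ A <;> by_cases a2 : s.tgt ∈ A <;>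
        by_cases a3 : D.𝔅.η A = some s.edge <;> by_cases a4 : D.EntersOnBase 𝒯 A <;>
        simp [InI, Xor, hM, a1, a2, a3, a4, hz] at e1 e2 ⊢
    simp only [weight, hM, if_true, hyz] at h1
    simp only [lgLevel, ioType, hM, if_true, IOType.opp, petalevel]
    linarith
  · have h1 := D.dominated s hstep hM
    have h2 : ∑ A ∈ D.𝔅.blossoms with (s.src ∈ A ∧ s.tgt ∈ A) ∨ InI D.edges D.𝔅 A s, D.z A ≤
        D.zIn .b s.tgt (D.entryValue 𝒯) + D.zIn .p s.src (D.entryValue 𝒯) := by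
      simp only [zIn, entryValue_eq_b, entryValue_eq_p, Finset.sum_filter]
      rw [← Finset.sum_add_distrib]
      refine Finset.sum_le_sum fun A hA => ?_
      have hz := D.z_nonneg A
      have e1 := hleave A
      have e2 := henter A
      have e3 : D.𝔅.η A = some s.edge → Xor (s.src ∈ A) (s.tgt ∈ A) := fun h' =>
        (crosses_step hstep A).mp (D.baseEdge_crosses hA h')
      by_cases a1 : s.src ∈ A <;> by_cases a2 : s.tgt ∈ A <;>
        by_cases a3 : D.𝔅.η A = some s.edge <;> by_cases a4 : D.EntersOnBase 𝒯 A <;>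
        simp [InI, Xor, hM, a1, a2, a3, a4, hz] at e1 e2 e3 ⊢
    simp only [weight, hM, if_false, hyz] at h1
    simp only [lgLevel, ioType, hM, if_false, IOType.opp, petalevel]
    linarith

/-- The levels along a trail match at its vertices. -/
lemma lgLevel_isChain (hT : D.IsAugmenting T) (𝒯 : Finset (OTrail V E)) :
    T.steps.IsChain fun s t => D.lgLevel 𝒯 (s.tgt, ioType D.edges s.edge) =
      D.lgLevel 𝒯 (t.src, (ioType D.edges t.edge).opp) := by
  have h1 := hT.walk.spec.1
  have h2 := hT.alternating
  rw [List.isChain_iff_getElem] at h1 h2 ⊢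
  intro n hn
  have h3 := h2 n hn
  rw [h1 n hn]
  congr 2
  unfold OppType at h3
  unfold ioType
  by_cases h4 : T.steps[n].edge ∈ D.edges <;> by_cases h5 : T.steps[n + 1].edge ∈ D.edges <;>
    simp_all [IOType.opp]

variable (S : SearchStructure D)

include S in
lemma lgLevel_start (hT : T ∈ 𝒯) (hfree : D.Free T.start) : D.lgLevel 𝒯 (T.start, .o) = 0 := by
  have h1 : D.zIn .p T.start (D.entryValue 𝒯) = 0 := by
    refine Finset.sum_eq_zero fun A hA => ?_
    rw [Finset.mem_filter, entryValue_eq_p] at hA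
    obtain ⟨h2, h3⟩ := S.base_eq_of_free hfree hA.1 hA.2.1
    refine absurd ?_ hA.2.2
    unfold EntersOnBase
    rw [h3]
    exact ⟨T, hT, h2.symm⟩
  simp only [lgLevel, petalevel, h1, D.y_free _ hfree]
  ring

end StructuredMatching

namespace StructuredMatching

variable {f : V → ℕ} {D : StructuredMatching G f} {𝒯 : Finset (OTrail V E)} {T : OTrail V E}

/-- No trail starts at the end of another one that is the base vertex of a free blossom, as its
deficiency is 1. So no trail enters a blossom at the end on the base edge. -/
lemma lgLevel_finish (S : SearchStructure D) (h : D.IsTrailCollection 𝒯) (hT : T ∈ 𝒯) :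
    D.lgLevel 𝒯 (T.finish, .i) = 1 + 2 * D.L := by
  have hfree := (h.augmenting T hT).finish_free
  have h1 : D.zIn .b T.finish (D.entryValue 𝒯) = 0 := by
    refine Finset.sum_eq_zero fun A hA => ?_
    rw [Finset.mem_filter, entryValue_eq_b] at hA
    obtain ⟨h2, h3⟩ := S.base_eq_of_free hfree hA.1 hA.2.1
    have h4 := hA.2.2
    unfold EntersOnBase at h4
    rw [h3] at h4
    obtain ⟨T', hT', h5⟩ := h4
    rw [h2] at h5
    have h6 := ((D.isBlossom A hA.1).free_light (h2.symm ▸ hfree)).2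
    have h7 := h.ends_le T.finish
    rw [h2] at h6
    rw [h6, Finset.sum_add_distrib] at h7
    have h8 := Finset.single_le_sum
      (f := fun T' : OTrail V E => if T'.start = T.finish then 1 else 0)
      (fun _ _ => Nat.zero_le _) hT'
    have h9 := Finset.single_le_sum
      (f := fun T' : OTrail V E => if T'.finish = T.finish then 1 else 0)
      (fun _ _ => Nat.zero_le _) hT
    simp only [h5, if_true] at h8 h9
    omega
  simp only [lgLevel, petalevel, h1, D.y_free _ hfree, L]
  ring

lemma isTrailCollection_singleton (hT : D.IsAugmenting T) : D.IsTrailCollection {T} := by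
  refine ⟨by simpa using hT, by simp, fun v => ?_⟩
  rw [Finset.sum_singleton]
  have h1 := hT.start_free.2
  have h2 := hT.finish_free.2
  have h3 := hT.closed
  split_ifs with h4 h5 h5
  · rw [← h4]; exact h3 (h4.trans h5.symm)
  · rw [← h4]; exact h1
  · rw [← h5]; exact h2
  · exact Nat.zero_le _

/-- The levels of a trail start at `0`. -/
lemma lgLevel_head (S : SearchStructure D) (hT : D.IsAugmenting T) (hmem : T ∈ 𝒯) {s : Step V E}
    (hs : s ∈ T.steps.head?) : D.lgLevel 𝒯 (s.src, (ioType D.edges s.edge).opp) = 0 := by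
  rw [hT.walk.spec.2.2.1 s hs]
  have : ioType D.edges s.edge = .i := by simp [ioType, hT.first_unmatched s hs]
  rw [this]
  exact lgLevel_start S hmem hT.start_free

/-- The levels of a trail end at `1 + 2L`. -/
lemma lgLevel_getLast (S : SearchStructure D) (h : D.IsTrailCollection 𝒯) (hmem : T ∈ 𝒯)
    {s : Step V E} (hs : s ∈ T.steps.getLast?) :
    D.lgLevel 𝒯 (s.tgt, ioType D.edges s.edge) = 1 + 2 * D.L := by
  have hT := h.augmenting T hmem
  rw [hT.walk.spec.2.2.2 s hs]
  have : ioType D.edges s.edge = .i := by simp [ioType, hT.last_unmatched s hs]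
  rw [this]
  exact lgLevel_finish S h hmem

/-- No augmenting trail is shorter than `1 + 2L`. -/
lemma le_length (S : SearchStructure D) (hT : D.IsAugmenting T) :
    1 + 2 * D.L ≤ (T.steps.length : ℝ) := by
  have h := isTrailCollection_singleton hT
  have hmem : T ∈ ({T} : Finset (OTrail V E)) := Finset.mem_singleton_self T
  obtain ⟨s, p, hp⟩ := List.exists_cons_of_ne_nil hT.ne_nil
  obtain ⟨t, ht⟩ : ∃ t, t ∈ T.steps.getLast? := by
    rw [List.getLast?_eq_some_getLast hT.ne_nil]; exact ⟨_, rfl⟩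
  have h0 := lgLevel_head S hT hmem (s := s) (by simp [hp])
  have h1 := lgLevel_getLast S h hmem ht
  have hc := lgLevel_isChain hT {T}
  have hle := fun u hu => lgLevel_step_le h hmem (s := u) hu (hT.walk.spec.2.1 u hu)
  rw [hp] at hc ht hle ⊢
  have h2 := level_le_add_length _ _ p s hc hle t ht
  rw [h0, h1] at h2
  linarith

lemma IntegralDuals.exists_lgLevel_eq (hI : D.IntegralDuals) {v₀ : V} (hv₀ : D.Free v₀)
    (𝒯 : Finset (OTrail V E)) {v : V} (hv : v ∈ V(G)) (j : IOType) :
    ∃ m : ℤ, D.lgLevel 𝒯 (v, j) = m := by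
  have hz : ∀ c, ∃ m : ℤ, D.zIn c v (D.entryValue 𝒯) = m := by
    intro c
    have h1 : D.zIn c v (D.entryValue 𝒯) ∈ (Int.castAddHom ℝ).range := by
      refine AddSubgroup.sum_mem _ fun A hA => ?_
      obtain ⟨m, hm⟩ := hI.2 A (Finset.mem_filter.mp hA).1
      exact ⟨m, hm.symm⟩
    obtain ⟨m, hm⟩ := h1
    exact ⟨m, hm.symm⟩
  obtain ⟨a, ha⟩ := hI.1 v hv
  obtain ⟨b, hb⟩ := hI.1 v₀ hv₀.1
  rw [D.y_free v₀ hv₀] at hb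
  cases j with
  | o =>
    obtain ⟨c, hc⟩ := hz .p
    exact ⟨a - b + c, by simp only [lgLevel, petalevel, ha, hb, hc]; push_cast; ring⟩
  | i =>
    obtain ⟨c, hc⟩ := hz .b
    exact ⟨1 - (a + b + c), by simp only [lgLevel, petalevel, ha, hb, hc]; push_cast; ring⟩

/-- With integral duals, every trail traverses every layer. -/
lemma exists_layer_step (S : SearchStructure D) (hI : D.IntegralDuals)
    (h : D.IsTrailCollection 𝒯) (hmem : T ∈ 𝒯) {k : ℕ} (hk : (k : ℝ) < 1 + 2 * D.L) :
    ∃ (n : ℕ) (hn : n < T.steps.length),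
      D.lgLevel 𝒯 (T.steps[n].src, (ioType D.edges T.steps[n].edge).opp) = k ∧
      D.lgLevel 𝒯 (T.steps[n].tgt, ioType D.edges T.steps[n].edge) = k + 1 := by
  have hT := h.augmenting T hmem
  have hstep := hT.walk.spec.2.1
  obtain ⟨s, p, hp⟩ := List.exists_cons_of_ne_nil hT.ne_nil
  have h0 := lgLevel_head S hT hmem (s := s) (by simp [hp])
  have hc := lgLevel_isChain hT 𝒯
  have hle := fun u hu => lgLevel_step_le h hmem (s := u) hu (hstep u hu)
  have hint : ∀ t ∈ T.steps,
      (∃ m : ℤ, D.lgLevel 𝒯 (t.src, (ioType D.edges t.edge).opp) = m) ∧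
      ∃ m : ℤ, D.lgLevel 𝒯 (t.tgt, ioType D.edges t.edge) = m := fun t ht =>
    ⟨hI.exists_lgLevel_eq hT.start_free 𝒯 (Graph.IsLink.left_mem (hstep t ht)) _,
      hI.exists_lgLevel_eq hT.start_free 𝒯 (Graph.IsLink.right_mem (hstep t ht)) _⟩
  have hlast : ∀ t ∈ T.steps.getLast?,
      (k : ℝ) < D.lgLevel 𝒯 (t.tgt, ioType D.edges t.edge) := fun t ht => by
    rwa [lgLevel_getLast S h hmem ht]
  have key := exists_step_in_layer
    (fun t : Step V E => D.lgLevel 𝒯 (t.src, (ioType D.edges t.edge).opp))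
    (fun t => D.lgLevel 𝒯 (t.tgt, ioType D.edges t.edge)) k p s
  rw [← hp] at key
  exact key hc hle hint (by rw [h0]; positivity) hlast

end StructuredMatching

end FMatch

theorem mainTheorem5 {V E : Type*} (G : Graph V E) (hV : V(G).Finite) (hE : E(G).Finite)
    (f : V → ℕ) (D : FMatch.StructuredMatching G f) (S : FMatch.SearchStructure D)
    (hS : S.FindsAugmentingTrail) :
    (∀ 𝒯 : Finset (FMatch.OTrail V E), D.IsTrailCollection 𝒯 → ∀ T ∈ 𝒯,
      D.petalevel .i T.finish (D.entrance 𝒯 T T.steps.length) = 1 + 2 * D.L) ∧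
    IsLeast {ℓ : ℝ | ∃ T : FMatch.OTrail V E, D.IsAugmenting T ∧ (T.steps.length : ℝ) = ℓ}
      (1 + 2 * D.L) ∧
    (D.IntegralDuals → ∀ 𝒯 : Finset (FMatch.OTrail V E), D.IsTrailCollection 𝒯 → ∀ T ∈ 𝒯,
      ∀ k : ℕ, (k : ℝ) < 1 + 2 * D.L →
        ∃ (n : ℕ) (hn : n < T.steps.length),
          let s := T.steps[n]
          let j := FMatch.ioType D.edges s.edge
          D.petalevel j.opp s.src (D.entrance 𝒯 T n) = k ∧
          D.petalevel j s.tgt (D.entrance 𝒯 T (n + 1)) = k + 1 ∧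
          D.IsLGEdge 𝒯 k s.edge (s.src, j.opp) (s.tgt, j)) := by
  refine ⟨fun 𝒯 h T hT => ?_, ⟨?_, ?_⟩, fun hI 𝒯 h T hT k hk => ?_⟩
  · rw [D.entrance_eq]
    exact FMatch.StructuredMatching.lgLevel_finish S h hT
  · obtain ⟨T, hT, hle⟩ := S.exists_isAugmenting hS hV
    exact ⟨T, hT, le_antisymm hle (FMatch.StructuredMatching.le_length S hT)⟩
  · rintro _ ⟨T, hT, rfl⟩
    exact FMatch.StructuredMatching.le_length S hT
  · obtain ⟨n, hn, h1, h2⟩ := FMatch.StructuredMatching.exists_layer_step S hI h hT hk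
    simp only [D.entrance_eq]
    have haug := h.augmenting T hT
    -- both the last level and `k` are integers
    obtain ⟨m, hm⟩ := hI.exists_lgLevel_eq haug.start_free 𝒯 haug.finish_free.1 .i
    rw [FMatch.StructuredMatching.lgLevel_finish S h hT] at hm
    refine ⟨n, hn, h1, h2, haug.walk.spec.2.1 _ (List.getElem_mem hn), h1, h2, ?_⟩
    rw [hm] at hk ⊢
    norm_cast at hk ⊢
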